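/- Fix integers $n \geq 2$ and $m_1,\dots,m_n \geq 2$. In a finite $n$-player normal-form game each player $i$ has a set $\mathcal{A}_i$ of $m_i$ actions and a utility $u_i : \mathcal{A} = \prod_j \mathcal{A}_j \to [-1,1]$. The game is played repeatedly; in round $t = 1, 2, \dots$ every player $i$ selects a mixed strategy $x_i^{(t)} \in \Delta(\mathcal{A}_i)$ and then observes, as its only feedback, the utility vector $u_i^{(t)} \in \mathbb{R}^{\mathcal{A}_i}$ with $u_i^{(t)}[a_i] = \mathbb{E}_{a_{-i} \sim x_{-i}^{(t)}}[u_i(a_i, a_{-i})]$. The average correlated distribution of play after $T$ rounds is $\bar\mu_T = \frac1T \sum_{t=1}^T x_1^{(t)} \otimes \dots \otimes x_n^{(t)}$. A probability distribution $\mu$ on $\mathcal{A}$ is an $\epsilon$-approximate correlated equilibrium ($\epsilon \geq 0$) if $\mathbb{E}_{a \sim \mu}[u_i(a)] \geq \mathbb{E}_{a\sim\mu}[u_i(\phi_i(a_i), a_{-i})] - \epsilon$ for every player $i$ and every $\phi_i : \mathcal{A}_i \to \mathcal{A}_i$. A learning algorithm is strongly uncoupled if a player running it knows nothing about the game (not even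 its own utility function) except its own number of actions $m$, an upper bound $N$ on the number of players and an upper bound $M$ on the numbers of actions of the players; it keeps a private memory consisting of a number (independent of time) of vectors in $\mathbb{R}^{m}$, plays a mixed strategy that is a continuous function of this memory, and updates the memory by a continuous function of the old memory and the observed utility vector. Then there are absolute constants $C, c$ and a strongly uncoupled learning algorithm storing $c\,m$ vectors such that, for all $N, M$, in every finite game with $2 \leq n \leq N$ players and $2 \leq m_i \leq M$ actions for each player $i$, when all players follow the algorithm, for every $T \geq 2$ the distribution $\bar\mu_T$ is an $\epsilon_T$-approximate correlated equilibrium with \[ \epsilon_T = C\, N M^{5/2}\, \frac{\log T}{T}. \] -/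

import Mathlib

/-- A finite game in normal form with players `Fin n`. Player `i` has the action set `Fin (m i)`
and a normalized utility function on joint action profiles, with values in `[-1, 1]`. -/
structure FiniteGame (n : ℕ) (m : Fin n → ℕ) where
  utility : Fin n → (∀ j, Fin (m j)) → ℝ
  utility_mem : ∀ i a, utility i a ∈ Set.Icc (-1 : ℝ) 1

/-- The product distribution `x 1 ⊗ ⋯ ⊗ x n` on joint action profiles. -/
def productDistribution {n : ℕ} {m : Fin n → ℕ} (x : ∀ j, Fin (m j) → ℝ) :
    (∀ j, Fin (m j)) → ℝ :=
  fun a => ∏ j, x j (a j)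

namespace FiniteGame

variable {n : ℕ} {m : Fin n → ℕ}

/-- The expected utility of player `i` under the joint mixed strategy profile `x`. -/
def expectedUtility (G : FiniteGame n m) (x : ∀ j, Fin (m j) → ℝ) (i : Fin n) : ℝ :=
  ∑ a, G.utility i a * productDistribution x a

/-- The utility vector observed by player `i` when the players use the mixed strategies `x`: its
coordinate at the action `b` is the expected utility of `i` when `i` plays `b` with certainty and
every other player `j` plays `x j`. -/
def feedback (G : FiniteGame n m) (x : ∀ j, Fin (m j) → ℝ) (i : Fin n) : Fin (m i) → ℝ :=
  fun b => G.expectedUtility (Function.update x i (Pi.single b 1)) i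

/-- `μ` is an `ε`-approximate correlated equilibrium: it is a probability distribution on joint
action profiles, and no player gains more than `ε` in expectation by a swap function. -/
def IsApproxCorrelatedEquilibrium (G : FiniteGame n m) (ε : ℝ) (μ : (∀ j, Fin (m j)) → ℝ) : Prop :=
  0 ≤ ε ∧ μ ∈ stdSimplex ℝ (∀ j, Fin (m j)) ∧
    ∀ (i : Fin n) (φ : Fin (m i) → Fin (m i)),
      ∑ a, μ a * G.utility i a ≥
        ∑ a, μ a * G.utility i (Function.update a i (φ (a i))) - ε

end FiniteGame

/-- A strongly uncoupled learning algorithm for a player with `m` actions, who privately stores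
`k` real vectors indexed by the actions. The next mixed strategy is a function of the private
memory, and the memory is updated from the utility vector received as feedback; no other
information (on the game, on the own utility function, on the other players) is available.
Both maps are required to be continuous, so that the memory is a genuine restriction (the whole
history of play cannot be packed into the digits of the stored numbers). -/
structure UncoupledLearner (m k : ℕ) where
  /-- the memory before the first round -/
  init : Fin k → Fin m → ℝ
  /-- the mixed strategy played with a given memory -/
  strategy : (Fin k → Fin m → ℝ) → (Fin m → ℝ)
  /-- the memory after a given utility vector is observed -/
  update : (Fin k → Fin m → ℝ) → (Fin m → ℝ) → (Fin k → Fin m → ℝ)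
  strategy_mem : ∀ s, strategy s ∈ stdSimplex ℝ (Fin m)
  continuous_strategy : Continuous strategy
  continuous_update : Continuous fun p : (Fin k → Fin m → ℝ) × (Fin m → ℝ) => update p.1 p.2

namespace FiniteGame

variable {n : ℕ} {m k : Fin n → ℕ}

/-- The memories of all players after `t` rounds of the repeated game `G`, when every player `i`
follows the learning algorithm `L i`. -/
def memoryAfter (G : FiniteGame n m) (L : ∀ i, UncoupledLearner (m i) (k i)) :
    ℕ → ∀ i, Fin (k i) → Fin (m i) → ℝ
  | 0 => fun i => (L i).init
  | t + 1 => fun i => (L i).update (G.memoryAfter L t i)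
      (G.feedback (fun j => (L j).strategy (G.memoryAfter L t j)) i)

/-- The mixed strategies played after `t` completed rounds, that is, in round `t + 1`. -/
def strategiesAfter (G : FiniteGame n m) (L : ∀ i, UncoupledLearner (m i) (k i)) (t : ℕ) :
    ∀ i, Fin (m i) → ℝ :=
  fun i => (L i).strategy (G.memoryAfter L t i)

/-- The average correlated distribution of play over the first `T` rounds: the average of the
product distributions of the mixed strategies played in these rounds. -/
noncomputable def averagePlay (G : FiniteGame n m) (L : ∀ i, UncoupledLearner (m i) (k i))
    (T : ℕ) : (∀ j, Fin (m j)) → ℝ :=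
  fun a => (1 / (T : ℝ)) * ∑ t ∈ Finset.range T, productDistribution (G.strategiesAfter L t) a

end FiniteGame

/-! Small swap regret of every player is exactly approximate correlated equilibrium of the average
play, so it suffices to keep each swap regret of order `log T`. Each player runs one external-regret
minimizer per own action `a`: optimistic follow-the-regularized-leader with the logarithmic barrier,
fed the observed utility vector scaled by `η * x a` and predicting that the last such vector recurs.
The leaders are the rows of a transition matrix, and the player plays its stationary distribution
`x`; by stationarity the component regrets add up to the swap regret (`IsSwapPlay.swapRegret_le`).
The regret bound contains negative Bregman terms. With the log barrier they control the relative
change of every entry of the matrix, and a stationary distribution changes by a relative amount at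
most twice the sum of the relative changes of the rows (`IsStationaryDist.abs_log_sub_log_le`). So
the negative terms dominate the squared movement of the play itself (`IsSwapPlay.sq_variation_le`),
which gives a swap regret plus own variation of at most `O(m ^ 2 log T)` plus `O(η ^ 2)` times the
squared variation of the utilities (`IsSwapPlay.swapRegret_add_variation_le`). The swap regret for
the identity is zero. Summing that case over the players therefore bounds the total variation of
play by `O(N M ^ 3 log T)` for `η` of order `1 / (N √M)`. Put back into the bound for one player,
this makes every swap regret `O(M ^ 2 log T / η)`. -/

/-! ### The log-barrier regularized leader: existence, continuity, divergences, stability. -/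

section LogBarrier

variable {ι : Type*} [Fintype ι]

/-- `s - 1 - log s`, the Bregman divergence of the logarithmic barrier in terms of a ratio. -/
noncomputable def logGap (s : ℝ) : ℝ := s - 1 - Real.log s

theorem logGap_nonneg {s : ℝ} (hs : 0 < s) : 0 ≤ logGap s := by
  have := Real.log_le_sub_one_of_pos hs
  unfold logGap; linarith

theorem logGap_add_logGap_inv {s : ℝ} (hs : 0 < s) :
    logGap s + logGap s⁻¹ = (s - 1) ^ 2 / s := by
  unfold logGap
  rw [Real.log_inv]
  field_simp
  ring

theorem logGap_le {s : ℝ} (hs : 0 < s) : logGap s ≤ (s - 1) ^ 2 / s := by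
  have := logGap_add_logGap_inv hs
  have := logGap_nonneg (inv_pos.2 hs)
  linarith

/-- Apply `log u ≤ u - 1` at `u = √s` rather than at `s`. -/
theorem sq_sqrt_sub_one_le_logGap {s : ℝ} (hs : 0 < s) : (√s - 1) ^ 2 ≤ logGap s := by
  have h := Real.log_le_sub_one_of_pos (Real.sqrt_pos.2 hs)
  rw [Real.log_sqrt hs.le] at h
  have := Real.sq_sqrt hs.le
  unfold logGap
  nlinarith

/-- Converse of `logGap_le`. The left side is `(√s - 1) ^ 2 * (1 + 1 / √s) ^ 2`, and the second
factor equals 9 at `s = 1 / 4`. -/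
theorem le_logGap {s : ℝ} (hs : 1 / 4 ≤ s) : (s - 1) ^ 2 / s ≤ 9 * logGap s := by
  have h0 : 0 < s := by linarith
  refine le_trans ?_ (mul_le_mul_of_nonneg_left (sq_sqrt_sub_one_le_logGap h0) (by norm_num))
  rw [div_le_iff₀ h0]
  have hq : 1 / 2 ≤ √s := Real.le_sqrt_of_sq_le (by norm_num; linarith)
  have hs2 : √s ^ 2 = s := Real.sq_sqrt h0.le
  have h1 : (s - 1) ^ 2 = (√s - 1) ^ 2 * (√s + 1) ^ 2 := by rw [← hs2]; simp; ring
  have h2 : 9 * (√s - 1) ^ 2 * s = (√s - 1) ^ 2 * (9 * √s ^ 2) := by rw [hs2]; ring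
  rw [h1, h2]
  apply mul_le_mul_of_nonneg_left _ (sq_nonneg _)
  nlinarith

/-- The right side is `4 * sinh (log s / 2) ^ 2`, and `|u| ≤ |sinh u|`. -/
theorem Real.sq_log_le_sq_sub_one_div {s : ℝ} (hs : 0 < s) : Real.log s ^ 2 ≤ (s - 1) ^ 2 / s := by
  have key : ∀ u : ℝ, 0 ≤ u → u ^ 2 ≤ Real.sinh u ^ 2 := fun u hu =>
    pow_le_pow_left₀ hu (Real.self_le_sinh_iff.2 hu) 2
  have key' : ∀ u : ℝ, u ^ 2 ≤ Real.sinh u ^ 2 := by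
    intro u
    rcases le_total 0 u with h | h
    · exact key u h
    · simpa using key (-u) (by linarith)
  have h := key' (Real.log s / 2)
  have hq : 0 < Real.exp (Real.log s / 2) := Real.exp_pos _
  have hq2 : Real.exp (Real.log s / 2) ^ 2 = s := by
    rw [← Real.exp_nat_mul]; push_cast; rw [mul_div_cancel₀ _ (by norm_num), Real.exp_log hs]
  rw [Real.sinh_eq, Real.exp_neg] at h
  have : (s - 1) ^ 2 / s = 4 * ((Real.exp (Real.log s / 2) - (Real.exp (Real.log s / 2))⁻¹) / 2) ^ 2 := by
    rw [← hq2]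
    simp only [Real.log_pow, Real.log_exp]
    field_simp
    push_cast
    ring_nf
  rw [this]
  linarith [h]

variable [Nonempty ι]

/-- The first-order condition for the leader is `L r + 1 / p r = l`. The intermediate value theorem
applies between `max L + 1`, where the largest term alone is 1, and `max L + card ι`, where every
term is at most `1 / card ι`. -/
theorem exists_barrierMultiplier (L : ι → ℝ) :
    ∃ l : ℝ, (∀ r, L r < l) ∧ ∑ r, (l - L r)⁻¹ = 1 := by
  obtain ⟨r₀, hr₀⟩ := Finite.exists_max L
  have hcard : (1 : ℝ) ≤ Fintype.card ι := by exact_mod_cast Fintype.card_pos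
  have hpos : ∀ l ∈ Set.Icc (L r₀ + 1) (L r₀ + Fintype.card ι), ∀ r, 0 < l - L r := by
    intro l hl r
    have := hr₀ r
    linarith [hl.1]
  have hcont : ContinuousOn (fun l : ℝ => ∑ r, (l - L r)⁻¹)
      (Set.Icc (L r₀ + 1) (L r₀ + Fintype.card ι)) := by
    refine continuousOn_finsetSum _ fun r _ => ContinuousOn.inv₀ (by fun_prop) ?_
    exact fun l hl => (hpos l hl r).ne'
  have hivt := intermediate_value_Icc' (by linarith) hcont
  have hmem : (1 : ℝ) ∈ Set.Icc (∑ r, (L r₀ + Fintype.card ι - L r)⁻¹)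
      (∑ r, (L r₀ + 1 - L r)⁻¹) := by
    constructor
    · calc ∑ r, (L r₀ + Fintype.card ι - L r)⁻¹ ≤ ∑ _r : ι, (Fintype.card ι : ℝ)⁻¹ := by
            refine Finset.sum_le_sum fun r _ => inv_anti₀ (by linarith) ?_
            linarith [hr₀ r]
        _ = 1 := by simp
    · have := Finset.single_le_sum (f := fun r => (L r₀ + 1 - L r)⁻¹)
        (fun r _ => (inv_pos.2 (by linarith [hr₀ r])).le) (Finset.mem_univ r₀)
      simpa using this
  obtain ⟨l, hl, hl'⟩ := hivt hmem
  exact ⟨l, fun r => by linarith [hpos l hl r], hl'⟩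

/-- The Lagrange multiplier of the log-barrier regularized leader for the cumulative utility `L`. -/
noncomputable def barrierMultiplier (L : ι → ℝ) : ℝ := (exists_barrierMultiplier L).choose

theorem lt_barrierMultiplier (L : ι → ℝ) (r : ι) : L r < barrierMultiplier L :=
  (exists_barrierMultiplier L).choose_spec.1 r

/-- The maximizer of `∑ r, (p r * L r + log (p r))` over the probability simplex. -/
noncomputable def barrierLeader (L : ι → ℝ) (r : ι) : ℝ := (barrierMultiplier L - L r)⁻¹

theorem barrierLeader_pos (L : ι → ℝ) (r : ι) : 0 < barrierLeader L r :=
  inv_pos.2 (by linarith [lt_barrierMultiplier L r])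

theorem sum_barrierLeader (L : ι → ℝ) : ∑ r, barrierLeader L r = 1 :=
  (exists_barrierMultiplier L).choose_spec.2

theorem barrierLeader_le_one (L : ι → ℝ) (r : ι) : barrierLeader L r ≤ 1 := by
  rw [← sum_barrierLeader L]
  exact Finset.single_le_sum (fun r _ => (barrierLeader_pos L r).le) (Finset.mem_univ r)

theorem eq_barrierMultiplier_sub (L : ι → ℝ) (r : ι) :
    L r = barrierMultiplier L - (barrierLeader L r)⁻¹ := by
  simp [barrierLeader]

/-- Otherwise every weight of the leader for `L` would be strictly below that for `L'`, while both
sum to 1. -/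
theorem barrierMultiplier_le {L L' : ι → ℝ} {ε : ℝ} (h : ∀ r, L r ≤ L' r + ε) :
    barrierMultiplier L ≤ barrierMultiplier L' + ε := by
  by_contra! hlt
  have : ∑ r, barrierLeader L r < ∑ r, barrierLeader L' r := by
    refine Finset.sum_lt_sum_of_nonempty Finset.univ_nonempty fun r _ => ?_
    have := lt_barrierMultiplier L' r
    exact inv_strictAnti₀ (by linarith) (by linarith [h r])
  simp [sum_barrierLeader] at this

theorem continuous_barrierMultiplier : Continuous (barrierMultiplier : (ι → ℝ) → ℝ) := by
  refine (LipschitzWith.of_dist_le_mul (K := 1) fun L L' => ?_).continuous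
  have hr : ∀ r, |L r - L' r| ≤ dist L L' := fun r => dist_le_pi_dist L L' r
  rw [NNReal.coe_one, one_mul, Real.dist_eq, abs_sub_le_iff]
  constructor
  · have := barrierMultiplier_le (L := L) (L' := L') (ε := dist L L')
      fun r => by linarith [(abs_le.1 (hr r)).2]
    linarith
  · have := barrierMultiplier_le (L := L') (L' := L) (ε := dist L L')
      fun r => by linarith [(abs_le.1 (hr r)).1]
    linarith

theorem continuous_barrierLeader (r : ι) : Continuous fun L : ι → ℝ => barrierLeader L r := by
  refine Continuous.inv₀ (continuous_barrierMultiplier.sub (continuous_apply r)) fun L => ?_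
  linarith [lt_barrierMultiplier L r]

/-- The log-barrier regularized objective. -/
noncomputable def barrierObjective (L p : ι → ℝ) : ℝ := ∑ r, (p r * L r + Real.log (p r))

/-- The optimal value of the log-barrier regularized objective. -/
noncomputable def barrierPotential (L : ι → ℝ) : ℝ := barrierObjective L (barrierLeader L)

/-- Substituting the first-order condition for `L` leaves the Bregman divergence of the barrier; the
multiplier drops out because both distributions have mass 1. -/
theorem barrierPotential_sub_barrierObjective (L : ι → ℝ) {p : ι → ℝ} (hp : ∀ r, 0 < p r)
    (hp1 : ∑ r, p r = 1) :
    barrierPotential L - barrierObjective L p = ∑ r, logGap (p r / barrierLeader L r) := by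
  have h : ∀ r, logGap (p r / barrierLeader L r) =
      (barrierLeader L r * L r + Real.log (barrierLeader L r)) - (p r * L r + Real.log (p r))
        + barrierMultiplier L * (p r - barrierLeader L r) := by
    intro r
    have hx := barrierLeader_pos L r
    rw [logGap, Real.log_div (hp r).ne' hx.ne']
    have hL : barrierLeader L r * L r = barrierMultiplier L * barrierLeader L r - 1 := by
      conv_lhs => rw [eq_barrierMultiplier_sub L r]
      field_simp
    have hL' : p r * L r = barrierMultiplier L * p r - p r / barrierLeader L r := by
      conv_lhs => rw [eq_barrierMultiplier_sub L r]
      ring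
    rw [hL, hL']
    ring
  rw [Finset.sum_congr rfl fun r _ => h r, Finset.sum_add_distrib, Finset.sum_sub_distrib,
    ← Finset.mul_sum, Finset.sum_sub_distrib, hp1, sum_barrierLeader]
  simp [barrierPotential, barrierObjective]

theorem barrierObjective_le_barrierPotential (L : ι → ℝ) {p : ι → ℝ} (hp : ∀ r, 0 < p r)
    (hp1 : ∑ r, p r = 1) : barrierObjective L p ≤ barrierPotential L := by
  have := barrierPotential_sub_barrierObjective L hp hp1
  have : 0 ≤ ∑ r, logGap (p r / barrierLeader L r) :=
    Finset.sum_nonneg fun r _ => logGap_nonneg (div_pos (hp r) (barrierLeader_pos L r))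
  linarith

/-- The Bregman divergence of the optimal value. -/
theorem barrierPotential_sub_barrierPotential (L L' : ι → ℝ) :
    barrierPotential L' - barrierPotential L = ∑ r, barrierLeader L r * (L' r - L r)
      + ∑ r, logGap (barrierLeader L r / barrierLeader L' r) := by
  rw [← barrierPotential_sub_barrierObjective L' (barrierLeader_pos L) (sum_barrierLeader L),
    barrierPotential, barrierPotential, barrierObjective, barrierObjective, barrierObjective]
  have : ∀ x y z : ℝ, y - z = x → x + (barrierObjective L' (barrierLeader L') - y) =
    barrierObjective L' (barrierLeader L') - z := fun x y z h => by linarith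
  symm
  refine this _ _ _ ?_
  rw [← Finset.sum_sub_distrib]
  exact Finset.sum_congr rfl fun r _ => by ring

theorem barrierPotential_zero : barrierPotential (0 : ι → ℝ) =
    ∑ _r : ι, Real.log (Fintype.card ι : ℝ)⁻¹ := by
  have h : ∀ r : ι, barrierLeader (0 : ι → ℝ) r = (Fintype.card ι : ℝ)⁻¹ := by
    intro r
    have h1 : ∀ r' : ι, barrierLeader (0 : ι → ℝ) r' = barrierLeader (0 : ι → ℝ) r := by
      intro r'; simp [barrierLeader]
    have h2 := sum_barrierLeader (0 : ι → ℝ)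
    rw [Finset.sum_congr rfl fun r' _ => h1 r'] at h2
    simp only [Finset.sum_const, Finset.card_univ, nsmul_eq_mul] at h2
    exact eq_inv_of_mul_eq_one_right h2
  simp [barrierPotential, barrierObjective, h]

/-- The left side is the symmetrized divergence, equal to the pairing of `x - y` with `L - L'`.
Young's inequality in the local norm absorbs half of it; the other half is at most `‖L - L'‖ ^ 2 /
2` because `∑ x r * y r ≤ 1`, so no dimension factor appears. -/
theorem sum_sq_ratio_barrierLeader_le (L L' : ι → ℝ) :
    ∑ r, (barrierLeader L r / barrierLeader L' r - 1) ^ 2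
      / (barrierLeader L r / barrierLeader L' r) ≤ ‖L - L'‖ ^ 2 := by
  set x := barrierLeader L
  set y := barrierLeader L'
  have hx : ∀ r, 0 < x r := barrierLeader_pos L
  have hy : ∀ r, 0 < y r := barrierLeader_pos L'
  have hE : ∑ r, (x r / y r - 1) ^ 2 / (x r / y r) = ∑ r, (x r - y r) * (L r - L' r) := by
    have h : ∀ r, (x r / y r - 1) ^ 2 / (x r / y r) = (x r - y r) * (L r - L' r)
        - (barrierMultiplier L - barrierMultiplier L') * (x r - y r) := by
      intro r
      rw [eq_barrierMultiplier_sub L r, eq_barrierMultiplier_sub L' r]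
      change _ = (x r - y r) * (barrierMultiplier L - (x r)⁻¹ - (barrierMultiplier L' - (y r)⁻¹)) - _
      have := hx r
      have := hy r
      field_simp
      ring
    rw [Finset.sum_congr rfl fun r _ => h r, Finset.sum_sub_distrib, ← Finset.mul_sum,
      Finset.sum_sub_distrib (f := x), sum_barrierLeader, sum_barrierLeader]
    simp
  have hterm : ∀ r, (x r - y r) * (L r - L' r) ≤
      (x r / y r - 1) ^ 2 / (x r / y r) / 2 + x r * ‖L - L'‖ ^ 2 / 2 := by
    intro r
    have h1 := hx r
    have h2 := hy r
    have hd : (L r - L' r) ^ 2 ≤ ‖L - L'‖ ^ 2 := by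
      rw [← sq_abs]
      exact pow_le_pow_left₀ (abs_nonneg _) (norm_le_pi_norm (L - L') r) 2
    have h3 : (x r / y r - 1) ^ 2 / (x r / y r) = (x r - y r) ^ 2 / (x r * y r) := by field_simp
    have h4 : (x r - y r) * (L r - L' r) ≤
        (x r - y r) ^ 2 / (x r * y r) / 2 + x r * y r * (L r - L' r) ^ 2 / 2 := by
      have h5 : (x r - y r) ^ 2 / (x r * y r) + x r * y r * (L r - L' r) ^ 2
          - 2 * ((x r - y r) * (L r - L' r))
          = ((x r - y r) - x r * y r * (L r - L' r)) ^ 2 / (x r * y r) := by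
        field_simp
        ring
      have h6 : 0 ≤ ((x r - y r) - x r * y r * (L r - L' r)) ^ 2 / (x r * y r) := by positivity
      linarith
    have h7 : x r * y r * (L r - L' r) ^ 2 ≤ x r * ‖L - L'‖ ^ 2 := by
      have : y r ≤ 1 := barrierLeader_le_one L' r
      rw [mul_assoc]
      refine mul_le_mul_of_nonneg_left ?_ h1.le
      nlinarith [sq_nonneg (L r - L' r)]
    rw [h3]
    linarith
  have hsum := Finset.sum_le_sum fun r (_ : r ∈ Finset.univ) => hterm r
  rw [← hE, Finset.sum_add_distrib, ← Finset.sum_div, ← Finset.sum_div, ← Finset.sum_mul,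
    sum_barrierLeader] at hsum
  linarith

theorem sum_logGap_barrierLeader_le (L L' : ι → ℝ) :
    ∑ r, logGap (barrierLeader L r / barrierLeader L' r) ≤ ‖L - L'‖ ^ 2 :=
  (Finset.sum_le_sum fun r _ => logGap_le
    (div_pos (barrierLeader_pos L r) (barrierLeader_pos L' r))).trans
    (sum_sq_ratio_barrierLeader_le L L')

theorem sq_log_barrierLeader_le (L L' : ι → ℝ) (r : ι) :
    (Real.log (barrierLeader L r) - Real.log (barrierLeader L' r)) ^ 2 ≤
      ∑ r, (barrierLeader L r / barrierLeader L' r - 1) ^ 2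
      / (barrierLeader L r / barrierLeader L' r) := by
  have hpos : ∀ r, 0 < barrierLeader L r / barrierLeader L' r := fun r =>
    div_pos (barrierLeader_pos L r) (barrierLeader_pos L' r)
  rw [← Real.log_div (barrierLeader_pos L r).ne' (barrierLeader_pos L' r).ne']
  refine (Real.sq_log_le_sq_sub_one_div (hpos r)).trans ?_
  exact Finset.single_le_sum (f := fun r => (barrierLeader L r / barrierLeader L' r - 1) ^ 2
      / (barrierLeader L r / barrierLeader L' r))
    (fun r _ => div_nonneg (sq_nonneg _) (hpos r).le) (Finset.mem_univ r)

/-- By stability each ratio `s` has `(s - 1) ^ 2 ≤ s`, which forces `s ≥ 1 / 4`, the range of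
`le_logGap`. This turns the negative regret terms into control of the entries. -/
theorem sum_sq_ratio_le_sum_logGap {L L' : ι → ℝ} (h : ‖L - L'‖ ≤ 1) :
    ∑ r, (barrierLeader L r / barrierLeader L' r - 1) ^ 2
      / (barrierLeader L r / barrierLeader L' r) ≤
    9 * ∑ r, logGap (barrierLeader L r / barrierLeader L' r) := by
  rw [Finset.mul_sum]
  refine Finset.sum_le_sum fun r _ => le_logGap ?_
  have hpos : ∀ r, 0 < barrierLeader L r / barrierLeader L' r := fun r =>
    div_pos (barrierLeader_pos L r) (barrierLeader_pos L' r)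
  have h1 := (Finset.single_le_sum (f := fun r => (barrierLeader L r / barrierLeader L' r - 1) ^ 2
      / (barrierLeader L r / barrierLeader L' r))
    (fun r _ => div_nonneg (sq_nonneg _) (hpos r).le) (Finset.mem_univ r)).trans
    (sum_sq_ratio_barrierLeader_le L L')
  have h2 : ‖L - L'‖ ^ 2 ≤ 1 := pow_le_one₀ (norm_nonneg _) h
  have h3 := (div_le_iff₀ (hpos r)).1 (h1.trans h2)
  by_contra! hlt
  nlinarith

end LogBarrier

/-! ### Stationary distributions and their multiplicative perturbation. -/

section Stationary

variable {ι : Type*} [Fintype ι]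

/-- Row-stochastic matrices with positive entries. -/
def IsPosStochastic (Q : ι → ι → ℝ) : Prop := (∀ a b, 0 < Q a b) ∧ ∀ a, ∑ b, Q a b = 1

/-- Stationary probability distributions of a transition matrix. -/
def IsStationaryDist (Q : ι → ι → ℝ) (π : ι → ℝ) : Prop :=
  π ∈ stdSimplex ℝ ι ∧ ∀ b, ∑ a, π a * Q a b = π b

theorem IsStationaryDist.pos {Q : ι → ι → ℝ} {π : ι → ℝ} (h : IsStationaryDist Q π)
    (hQ : IsPosStochastic Q) (b : ι) : 0 < π b := by
  have h0 : ∀ a, 0 ≤ π a * Q a b := fun a => mul_nonneg (h.1.1 a) (hQ.1 a b).le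
  rw [← h.2 b]
  refine (Finset.sum_nonneg fun a _ => h0 a).lt_of_ne fun heq => ?_
  have h1 := (Finset.sum_eq_zero_iff_of_nonneg fun a _ => h0 a).1 heq.symm
  have h2 : ∀ a, π a = 0 := fun a =>
    (mul_eq_zero.1 (h1 a (Finset.mem_univ a))).resolve_right (hQ.1 a b).ne'
  have h3 := h.1.2
  simp [h2] at h3

/-- Since `1 - Q` kills the constant vector, it also has a nonzero left null vector `v`. By the
triangle inequality `|v| ≤ |v| Q` entrywise, with equal total mass, hence with equality. -/
theorem IsPosStochastic.exists_isStationaryDist [Nonempty ι] {Q : ι → ι → ℝ}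
    (hQ : IsPosStochastic Q) : ∃ π, IsStationaryDist Q π := by
  classical
  have hdet : (1 - Matrix.of Q).det = 0 := by
    refine Matrix.exists_mulVec_eq_zero_iff.1 ⟨fun _ => 1, ?_, ?_⟩
    · exact fun h => one_ne_zero (congrFun h (Classical.arbitrary ι))
    · ext a
      simp [Matrix.mulVec, dotProduct, hQ.2 a, Matrix.one_apply]
  obtain ⟨v, hv, hvQ⟩ := Matrix.exists_vecMul_eq_zero_iff.2 hdet
  have hfix : ∀ b, ∑ a, v a * Q a b = v b := by
    intro b
    have := congrFun hvQ b
    simp only [Matrix.vecMul_sub, Matrix.vecMul_one, Pi.sub_apply, Pi.zero_apply] at this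
    simpa [Matrix.vecMul, dotProduct] using (sub_eq_zero.1 this).symm
  have hle : ∀ b, |v b| ≤ ∑ a, |v a| * Q a b := by
    intro b
    nth_rw 1 [← hfix b]
    refine (Finset.abs_sum_le_sum_abs _ _).trans (le_of_eq ?_)
    refine Finset.sum_congr rfl fun a _ => ?_
    rw [abs_mul, abs_of_pos (hQ.1 a b)]
  have hsum : ∑ b, |v b| = ∑ b, ∑ a, |v a| * Q a b := by
    rw [Finset.sum_comm]
    refine Finset.sum_congr rfl fun a _ => ?_
    rw [← Finset.mul_sum, hQ.2 a, mul_one]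
  have heq := (Finset.sum_eq_sum_iff_of_le fun b _ => hle b).1 hsum
  have hpos : 0 < ∑ b, |v b| := by
    obtain ⟨a, ha⟩ := Function.ne_iff.1 hv
    exact Finset.sum_pos' (fun b _ => abs_nonneg _) ⟨a, Finset.mem_univ a, abs_pos.2 ha⟩
  refine ⟨fun b => |v b| / ∑ c, |v c|, ⟨fun b => by positivity, ?_⟩, fun b => ?_⟩
  · rw [← Finset.sum_div, div_self hpos.ne']
  · simp only
    rw [heq b (Finset.mem_univ b), Finset.sum_div]
    exact Finset.sum_congr rfl fun a _ => by ring

/-- Minimum principle: increasing the off-diagonal part of one row by at most a factor `κ`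
increases the stationary weights relative to that row's state by at most the factor `κ`. -/
theorem IsStationaryDist.mul_le_of_row_le {Q Q' : ι → ι → ℝ} {π π' : ι → ℝ} {a : ι} {κ : ℝ}
    (hQ : IsPosStochastic Q) (hπ : IsStationaryDist Q π) (hπ' : IsStationaryDist Q' π')
    (hrow : ∀ b, Q' a b ≤ κ * Q a b) (hκ : 1 ≤ κ) (hne : ∀ c, c ≠ a → Q' c = Q c) (b : ι) :
    π' b * π a ≤ κ * (π b * π' a) := by
  classical
  set v : ι → ℝ := fun b => κ * (π b * π' a) - π' b * π a with hv
  have hva : 0 ≤ v a := by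
    have : 0 ≤ π a * π' a := mul_nonneg (hπ.1.1 a) (hπ'.1.1 a)
    simp only [hv]
    nlinarith
  -- Invariance of `π` and `π'` makes `v` superinvariant for the chain killed at `a`; only the term
  -- of row `a` is not an equality, and it has the right sign.
  have hstep : ∀ b, ∑ c ∈ Finset.univ.erase a, v c * Q c b ≤ v b := by
    intro b
    have h1 : v b = κ * π' a * ∑ c, π c * Q c b - π a * ∑ c, π' c * Q' c b := by
      rw [hπ.2, hπ'.2]; simp only [hv]; ring
    rw [h1, ← Finset.add_sum_erase _ _ (Finset.mem_univ a),
      ← Finset.add_sum_erase _ (fun c => π' c * Q' c b) (Finset.mem_univ a)]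
    have h2 : ∑ c ∈ Finset.univ.erase a, v c * Q c b =
        κ * π' a * ∑ c ∈ Finset.univ.erase a, π c * Q c b
          - π a * ∑ c ∈ Finset.univ.erase a, π' c * Q' c b := by
      rw [Finset.mul_sum, Finset.mul_sum, ← Finset.sum_sub_distrib]
      refine Finset.sum_congr rfl fun c hc => ?_
      rw [hne c (Finset.ne_of_mem_erase hc)]
      simp only [hv]; ring
    rw [h2]
    have h3 : 0 ≤ π a * π' a * (κ * Q a b - Q' a b) :=
      mul_nonneg (mul_nonneg (hπ.1.1 a) (hπ'.1.1 a)) (sub_nonneg.2 (hrow b))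
    nlinarith
  -- The negative part of `v` vanishes at `a` and is subinvariant for the killed chain. That chain
  -- loses mass `w c * Q c a` from each state `c`, and `Q c a > 0`, so `w = 0`.
  set w : ι → ℝ := fun b => max (-v b) 0 with hw
  have hw0 : ∀ b, 0 ≤ w b := fun b => le_max_right _ _
  have hwa : w a = 0 := max_eq_right (by linarith)
  have hwstep : ∀ b, w b ≤ ∑ c ∈ Finset.univ.erase a, w c * Q c b := by
    intro b
    refine max_le ?_ (Finset.sum_nonneg fun c _ => mul_nonneg (hw0 c) (hQ.1 c b).le)
    refine (neg_le_neg (hstep b)).trans ?_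
    rw [← Finset.sum_neg_distrib]
    refine Finset.sum_le_sum fun c _ => ?_
    rw [← neg_mul]
    exact mul_le_mul_of_nonneg_right (le_max_left _ _) (hQ.1 c b).le
  have hsum : ∑ c ∈ Finset.univ.erase a, w c ≤
      ∑ c ∈ Finset.univ.erase a, w c * (1 - Q c a) := by
    refine (Finset.sum_le_sum fun b _ => hwstep b).trans (le_of_eq ?_)
    rw [Finset.sum_comm]
    refine Finset.sum_congr rfl fun c _ => ?_
    rw [← Finset.mul_sum, ← hQ.2 c, ← Finset.add_sum_erase _ (Q c) (Finset.mem_univ a)]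
    ring
  have hzero : ∑ c ∈ Finset.univ.erase a, w c * Q c a = 0 := by
    refine le_antisymm ?_ (Finset.sum_nonneg fun c _ => mul_nonneg (hw0 c) (hQ.1 c a).le)
    simp only [mul_sub, mul_one, Finset.sum_sub_distrib] at hsum
    linarith
  have hwb : w b = 0 := by
    by_cases hb : b = a
    · rw [hb, hwa]
    · have := (Finset.sum_eq_zero_iff_of_nonneg fun c _ =>
        mul_nonneg (hw0 c) (hQ.1 c a).le).1 hzero b (Finset.mem_erase.2 ⟨hb, Finset.mem_univ b⟩)
      exact (mul_eq_zero.1 this).resolve_right (hQ.1 b a).ne'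
  have := le_max_left (-v b) 0
  simp only [hw] at hwb
  rw [hwb] at this
  simp only [hv] at this
  linarith

/-- One factor `κ` comes from the weights relative to state `a`. The other comes from the weight of
`a` itself, obtained by summing the reversed inequality over all states. -/
theorem IsStationaryDist.le_of_row_le {Q Q' : ι → ι → ℝ} {π π' : ι → ℝ} {a : ι} {κ : ℝ}
    (hQ : IsPosStochastic Q) (hQ' : IsPosStochastic Q')
    (hπ : IsStationaryDist Q π) (hπ' : IsStationaryDist Q' π')
    (hrow : ∀ b, Q' a b ≤ κ * Q a b) (hrow' : ∀ b, Q a b ≤ κ * Q' a b)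
    (hκ : 1 ≤ κ) (hne : ∀ c, c ≠ a → Q' c = Q c) (b : ι) :
    π' b ≤ κ ^ 2 * π b := by
  have h1 := hπ.mul_le_of_row_le hQ hπ' hrow hκ hne
  have h2 := hπ'.mul_le_of_row_le hQ' hπ hrow' hκ fun c hc => (hne c hc).symm
  have h3 : π' a ≤ κ * π a := by
    have := Finset.sum_le_sum fun b (_ : b ∈ Finset.univ) => h2 b
    rwa [← Finset.sum_mul, ← Finset.mul_sum, ← Finset.sum_mul, hπ.1.2, hπ'.1.2, one_mul,
      one_mul] at this
  have ha := hπ.pos hQ a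
  have hb := hπ.pos hQ b
  refine le_of_mul_le_mul_right ((h1 b).trans ?_) ha
  calc κ * (π b * π' a) ≤ κ * (π b * (κ * π a)) := by gcongr
    _ = κ ^ 2 * π b * π a := by ring

theorem IsStationaryDist.abs_log_sub_log_le_of_row {Q Q' : ι → ι → ℝ} {π π' : ι → ℝ} {a : ι} {ρ : ℝ}
    (hQ : IsPosStochastic Q) (hQ' : IsPosStochastic Q')
    (hπ : IsStationaryDist Q π) (hπ' : IsStationaryDist Q' π')
    (hrow : ∀ b, |Real.log (Q' a b) - Real.log (Q a b)| ≤ ρ)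
    (hne : ∀ c, c ≠ a → Q' c = Q c) (b : ι) :
    |Real.log (π' b) - Real.log (π b)| ≤ 2 * ρ := by
  have hρ : 0 ≤ ρ := (abs_nonneg _).trans (hrow b)
  have key : ∀ x y : ℝ, 0 < x → 0 < y → Real.log x - Real.log y ≤ ρ → x ≤ Real.exp ρ * y := by
    intro x y hx hy h
    rw [← Real.log_le_log_iff hx (by positivity), Real.log_mul (Real.exp_pos _).ne' hy.ne',
      Real.log_exp]
    linarith
  have h1 : ∀ b, Q' a b ≤ Real.exp ρ * Q a b := fun b =>
    key _ _ (hQ'.1 a b) (hQ.1 a b) (abs_le.1 (hrow b)).2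
  have h2 : ∀ b, Q a b ≤ Real.exp ρ * Q' a b := fun b =>
    key _ _ (hQ.1 a b) (hQ'.1 a b) (by linarith [(abs_le.1 (hrow b)).1])
  have hκ : 1 ≤ Real.exp ρ := Real.one_le_exp hρ
  have h3 := hπ.le_of_row_le hQ hQ' hπ' h1 h2 hκ hne b
  have h4 := hπ'.le_of_row_le hQ' hQ hπ h2 h1 hκ (fun c hc => (hne c hc).symm) b
  have key2 : ∀ x y : ℝ, 0 < x → 0 < y → x ≤ Real.exp ρ ^ 2 * y →
      Real.log x - Real.log y ≤ 2 * ρ := by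
    intro x y hx hy h
    have := Real.log_le_log hx h
    rw [Real.log_mul (by positivity) hy.ne', Real.log_pow, Real.log_exp] at this
    push_cast at this
    linarith
  have hp := hπ.pos hQ b
  have hp' := hπ'.pos hQ' b
  rw [abs_sub_le_iff]
  exact ⟨key2 _ _ hp' hp h3, key2 _ _ hp hp' h4⟩

/-- Multiplicative perturbation bound for stationary distributions. -/
theorem IsStationaryDist.abs_log_sub_log_le [Nonempty ι] {Q Q' : ι → ι → ℝ} {π π' : ι → ℝ}
    {ρ : ι → ℝ} (hQ : IsPosStochastic Q) (hQ' : IsPosStochastic Q')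
    (hπ : IsStationaryDist Q π) (hπ' : IsStationaryDist Q' π')
    (hrow : ∀ a b, |Real.log (Q' a b) - Real.log (Q a b)| ≤ ρ a) (b : ι) :
    |Real.log (π' b) - Real.log (π b)| ≤ 2 * ∑ a, ρ a := by
  classical
  -- Replace the rows of `Q` by those of `Q'` one at a time; row `a` costs `2 * ρ a`.
  have key : ∀ s : Finset ι, ∀ σ, IsStationaryDist (fun a => if a ∈ s then Q' a else Q a) σ →
      |Real.log (σ b) - Real.log (π b)| ≤ 2 * ∑ a ∈ s, ρ a := by
    intro s
    have hs : ∀ s : Finset ι, IsPosStochastic (fun a => if a ∈ s then Q' a else Q a) := by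
      intro s
      refine ⟨fun a b => ?_, fun a => ?_⟩ <;> by_cases ha : a ∈ s <;>
        simp only [ha, if_true, if_false]
      exacts [hQ'.1 a b, hQ.1 a b, hQ'.2 a, hQ.2 a]
    induction s using Finset.induction_on with
    | empty =>
      intro σ hσ
      have := hπ.abs_log_sub_log_le_of_row (a := b) (ρ := 0) hQ hQ (by simpa using hσ)
        (by simp) (by simp) b
      simpa using this
    | insert a s ha ih =>
      intro σ hσ
      obtain ⟨τ, hτ⟩ := (hs s).exists_isStationaryDist
      have h1 := ih τ hτ
      have h2 := hτ.abs_log_sub_log_le_of_row (a := a) (ρ := ρ a) (hs s) (hs (insert a s)) hσ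
        (by simpa [ha] using hrow a) (fun c hc => by simp [hc]) b
      rw [Finset.sum_insert ha]
      have := abs_sub_le (Real.log (σ b)) (Real.log (τ b)) (Real.log (π b))
      linarith
  exact key Finset.univ π' (by simpa using hπ')

theorem abs_sub_le_abs_log_sub_log_mul_add {x y : ℝ} (hx : 0 < x) (hy : 0 < y) :
    |x - y| ≤ |Real.log x - Real.log y| * (x + y) := by
  wlog h : y ≤ x generalizing x y
  · rw [abs_sub_comm, abs_sub_comm (Real.log x), add_comm]
    exact this hy hx (le_of_not_ge h)
  have h1 := Real.log_le_sub_one_of_pos (div_pos hy hx)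
  rw [Real.log_div hy.ne' hx.ne'] at h1
  have h2 : y / x * x = y := div_mul_cancel₀ _ hx.ne'
  have h3 : 0 ≤ Real.log x - Real.log y := sub_nonneg.2 (Real.log_le_log hy h)
  rw [abs_of_nonneg (sub_nonneg.2 h), abs_of_nonneg h3]
  nlinarith

/-- The relative bound is weighted by `π' + π`, of total mass 2, so passing to the `ℓ¹` distance
costs no factor `card ι`. -/
theorem IsStationaryDist.sum_abs_sub_le [Nonempty ι] {Q Q' : ι → ι → ℝ} {π π' : ι → ℝ}
    {ρ : ι → ℝ} (hQ : IsPosStochastic Q) (hQ' : IsPosStochastic Q')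
    (hπ : IsStationaryDist Q π) (hπ' : IsStationaryDist Q' π')
    (hrow : ∀ a b, |Real.log (Q' a b) - Real.log (Q a b)| ≤ ρ a) :
    ∑ b, |π' b - π b| ≤ 4 * ∑ a, ρ a := by
  calc ∑ b, |π' b - π b| ≤ ∑ b, 2 * (∑ a, ρ a) * (π' b + π b) := by
        refine Finset.sum_le_sum fun b _ => ?_
        have hp := hπ.pos hQ b
        have hp' := hπ'.pos hQ' b
        refine (abs_sub_le_abs_log_sub_log_mul_add hp' hp).trans ?_
        exact mul_le_mul_of_nonneg_right (hπ.abs_log_sub_log_le hQ hQ' hπ' hrow b) (by linarith)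
    _ = 4 * ∑ a, ρ a := by
        rw [← Finset.mul_sum, Finset.sum_add_distrib, hπ'.1.2, hπ.1.2]; ring

/-- The stationary distribution of a positive stochastic matrix. -/
noncomputable def stationary (Q : ι → ι → ℝ) : ι → ℝ := Classical.epsilon (IsStationaryDist Q)

theorem IsPosStochastic.isStationaryDist [Nonempty ι] {Q : ι → ι → ℝ} (hQ : IsPosStochastic Q) :
    IsStationaryDist Q (stationary Q) := Classical.epsilon_spec hQ.exists_isStationaryDist

/-- The perturbation bound holds for any choice of stationary distributions, so it gives continuity
although `stationary` is chosen by `Classical.epsilon`. -/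
theorem continuous_stationary [Nonempty ι] {X : Type*} [TopologicalSpace X] {Q : X → ι → ι → ℝ}
    (hQ : ∀ s, IsPosStochastic (Q s)) (hc : ∀ a b, Continuous fun s => Q s a b) :
    Continuous fun s => stationary (Q s) := by
  refine continuous_pi fun b => ?_
  have hlog : Continuous fun s => Real.log (stationary (Q s) b) := by
    refine continuous_iff_continuousAt.2 fun s₀ => ?_
    refine tendsto_iff_dist_tendsto_zero.2 ?_
    have hbound : Filter.Tendsto
        (fun s => 2 * ∑ a, ∑ b, |Real.log (Q s a b) - Real.log (Q s₀ a b)|) (nhds s₀) (nhds 0) := by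
      have : Continuous fun s => 2 * ∑ a, ∑ b, |Real.log (Q s a b) - Real.log (Q s₀ a b)| := by
        refine continuous_const.mul (continuous_finsetSum _ fun a _ =>
          continuous_finsetSum _ fun b _ => ?_)
        exact (((hc a b).log fun s => ((hQ s).1 a b).ne').sub continuous_const).abs
      simpa using this.tendsto s₀
    refine squeeze_zero (fun _ => dist_nonneg) (fun s => ?_) hbound
    rw [Real.dist_eq]
    refine (hQ s₀).isStationaryDist.abs_log_sub_log_le (hQ s₀) (hQ s) (hQ s).isStationaryDist
      (fun a b => ?_) b
    exact Finset.single_le_sum (f := fun b => |Real.log (Q s a b) - Real.log (Q s₀ a b)|)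
      (fun _ _ => abs_nonneg _) (Finset.mem_univ b)
  refine (Real.continuous_exp.comp hlog).congr fun s => ?_
  exact Real.exp_log ((hQ s).isStationaryDist.pos (hQ s) b)

end Stationary

/-! ### Swap regret of the optimistic minimizer against arbitrary bounded utilities. -/

section SwapRegret

variable {ι : Type*} [Fintype ι] [Nonempty ι]

/-- Regret of the optimistic log-barrier regularized leader with predictions `m`. -/
theorem barrierLeader_regret_le {g m L : ℕ → ι → ℝ} (hL0 : L 0 = 0)
    (hL : ∀ t, L (t + 1) = L t + g t) {p : ι → ℝ} (hp : ∀ r, 0 < p r) (hp1 : ∑ r, p r = 1)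
    (T : ℕ) :
    ∑ t ∈ Finset.range T, ∑ r, (p r - barrierLeader (L t + m t) r) * g t r ≤
      ∑ r, (Real.log (Fintype.card ι : ℝ)⁻¹ - Real.log (p r))
      + ∑ t ∈ Finset.range T, ‖g t - m t‖ ^ 2
      - ∑ t ∈ Finset.range T,
          ∑ r, logGap (barrierLeader (L t + m t) r / barrierLeader (L t) r) := by
  -- Expand the potential at both endpoints around the optimistic point `L t + m t`, whose leader is
  -- the one played. The divergence to `L (t + 1)` is a squared prediction error; the one to `L t`
  -- is kept with its negative sign.
  have hstep : ∀ t, barrierPotential (L (t + 1)) - barrierPotential (L t) ≤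
      ∑ r, barrierLeader (L t + m t) r * g t r + ‖g t - m t‖ ^ 2
      - ∑ r, logGap (barrierLeader (L t + m t) r / barrierLeader (L t) r) := by
    intro t
    have h1 := barrierPotential_sub_barrierPotential (L t + m t) (L (t + 1))
    have h2 := barrierPotential_sub_barrierPotential (L t + m t) (L t)
    have h3 := sum_logGap_barrierLeader_le (L t + m t) (L (t + 1))
    have h4 : ‖L t + m t - L (t + 1)‖ = ‖g t - m t‖ := by
      rw [hL, ← norm_neg]; congr 1; abel
    have h5 : ∑ r, barrierLeader (L t + m t) r * g t r =
        ∑ r, barrierLeader (L t + m t) r * (L (t + 1) r - (L t + m t) r)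
        - ∑ r, barrierLeader (L t + m t) r * (L t r - (L t + m t) r) := by
      rw [← Finset.sum_sub_distrib]
      refine Finset.sum_congr rfl fun r _ => ?_
      simp only [hL, Pi.add_apply]
      ring
    rw [h4] at h3
    linarith
  have hsum := Finset.sum_le_sum fun t (_ : t ∈ Finset.range T) => hstep t
  rw [Finset.sum_range_sub (fun t => barrierPotential (L t)), Finset.sum_sub_distrib,
    Finset.sum_add_distrib] at hsum
  have hobj := barrierObjective_le_barrierPotential (L T) hp hp1
  have hLT : ∀ r, ∑ t ∈ Finset.range T, g t r = L T r := by
    intro r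
    have := Finset.sum_range_sub (fun t => L t r) T
    simp only [hL0, Pi.zero_apply, sub_zero] at this
    rw [← this]
    exact Finset.sum_congr rfl fun t _ => by simp [hL]
  have hpL : ∑ t ∈ Finset.range T, ∑ r, p r * g t r = ∑ r, p r * L T r := by
    rw [Finset.sum_comm]
    exact Finset.sum_congr rfl fun r _ => by rw [← hLT r, Finset.mul_sum]
  have h0 : barrierPotential (L 0) = ∑ _r : ι, Real.log (Fintype.card ι : ℝ)⁻¹ := by
    rw [hL0, barrierPotential_zero]
  rw [barrierObjective, Finset.sum_add_distrib] at hobj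
  simp only [sub_mul, Finset.sum_sub_distrib] at *
  linarith

/-- The strategy of the swap-regret minimizer with cumulative utilities `S` and predictions `P` of
its component external-regret minimizers. -/
noncomputable def swapStrategy (S P : ι → ι → ℝ) : ι → ℝ :=
  stationary fun a => barrierLeader (S a + P a)

theorem isPosStochastic_barrierLeader (L : ι → ι → ℝ) :
    IsPosStochastic fun a => barrierLeader (L a) :=
  ⟨fun a => barrierLeader_pos (L a), fun a => sum_barrierLeader (L a)⟩

theorem isStationaryDist_swapStrategy (S P : ι → ι → ℝ) :
    IsStationaryDist (fun a => barrierLeader (S a + P a)) (swapStrategy S P) :=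
  (isPosStochastic_barrierLeader fun a => S a + P a).isStationaryDist

theorem Continuous.swapStrategy {X : Type*} [TopologicalSpace X] {S P : X → ι → ι → ℝ}
    (hS : Continuous S) (hP : Continuous P) : Continuous fun s => swapStrategy (S s) (P s) := by
  refine continuous_stationary (fun s => isPosStochastic_barrierLeader fun a => S s a + P s a)
    fun a b => (continuous_barrierLeader b).comp ?_
  exact ((continuous_apply a).comp hS).add ((continuous_apply a).comp hP)

/-- `x` is the play of the optimistic swap-regret minimizer with learning rate `η` against the
utility vectors `u`, with cumulative utilities `S` and predictions `P`. -/
structure IsSwapPlay (η : ℝ) (u x : ℕ → ι → ℝ) (S P : ℕ → ι → ι → ℝ) : Prop where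
  S_zero : ∀ a, S 0 a = 0
  P_zero : ∀ a, P 0 a = 0
  S_succ : ∀ t a, S (t + 1) a = S t a + (η * x t a) • u t
  P_succ : ∀ t a, P (t + 1) a = (η * x t a) • u t
  strategy : ∀ t, x t = swapStrategy (S t) (P t)
  rate_nonneg : 0 ≤ η
  norm_le_one : ∀ t, ‖u t‖ ≤ 1

namespace IsSwapPlay

variable {η : ℝ} {u x : ℕ → ι → ℝ} {S P : ℕ → ι → ι → ℝ}

theorem isStationaryDist (h : IsSwapPlay η u x S P) (t : ℕ) :
    IsStationaryDist (fun a => barrierLeader (S t a + P t a)) (x t) := by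
  rw [h.strategy t]; exact isStationaryDist_swapStrategy _ _

theorem nonneg (h : IsSwapPlay η u x S P) (t : ℕ) (a : ι) : 0 ≤ x t a :=
  (h.isStationaryDist t).1.1 a

theorem sum_eq_one (h : IsSwapPlay η u x S P) (t : ℕ) : ∑ a, x t a = 1 :=
  (h.isStationaryDist t).1.2

theorem le_one (h : IsSwapPlay η u x S P) (t : ℕ) (a : ι) : x t a ≤ 1 := by
  rw [← h.sum_eq_one t]
  exact Finset.single_le_sum (fun a _ => h.nonneg t a) (Finset.mem_univ a)

theorem abs_le_one (h : IsSwapPlay η u x S P) (t : ℕ) (a : ι) : |u t a| ≤ 1 :=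
  (norm_le_pi_norm (u t) a).trans (h.norm_le_one t)

/-- By stationarity the components together earn what the player earns, so their regrets against the
actions `φ a` sum to the swap regret. -/
theorem swapRegret_le (h : IsSwapPlay η u x S P) {T : ℕ} (hT : 2 ≤ T) (φ : ι → ι) :
    η * ∑ t ∈ Finset.range T, ∑ a, x t a * (u t (φ a) - u t a) ≤
      (Fintype.card ι : ℝ) ^ 2 * Real.log T + 2 * η
      + ∑ t ∈ Finset.range T, ∑ a, ‖(η * x t a) • u t - P t a‖ ^ 2
      - ∑ t ∈ Finset.range T, ∑ a,
          ∑ r, logGap (barrierLeader (S t a + P t a) r / barrierLeader (S t a) r) := by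
  classical
  have hT0 : (2 : ℝ) ≤ T := by exact_mod_cast hT
  have hTpos : (0 : ℝ) < T := by linarith
  have hTinv : (T : ℝ)⁻¹ ≤ 1 := inv_le_one_of_one_le₀ (by linarith)
  have hcard : (0 : ℝ) < Fintype.card ι := by exact_mod_cast Fintype.card_pos
  -- The vertex `φ a` has infinite barrier, so a fraction `1 / T` of the uniform distribution is
  -- mixed in. The barrier cost is then at most `log T` per entry, and the mixing loses at most `2 *
  -- η / T` per round.
  set p : ι → ι → ℝ := fun a r =>
    (1 - (T : ℝ)⁻¹) * (if r = φ a then 1 else 0) + (T : ℝ)⁻¹ * (Fintype.card ι : ℝ)⁻¹ with hp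
  have hple : ∀ a r, (T : ℝ)⁻¹ * (Fintype.card ι : ℝ)⁻¹ ≤ p a r := by
    intro a r
    have : 0 ≤ (1 - (T : ℝ)⁻¹) * (if r = φ a then 1 else 0) :=
      mul_nonneg (by linarith) (by split_ifs <;> norm_num)
    simp only [hp]
    linarith
  have hppos : ∀ a r, 0 < p a r := fun a r => lt_of_lt_of_le (by positivity) (hple a r)
  have hp1 : ∀ a, ∑ r, p a r = 1 := by
    intro a
    simp only [hp, Finset.sum_add_distrib, ← Finset.mul_sum]
    simp [hcard.ne']
  have hlog : ∀ a, ∑ r, (Real.log (Fintype.card ι : ℝ)⁻¹ - Real.log (p a r)) ≤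
      Fintype.card ι * Real.log T := by
    intro a
    rw [← nsmul_eq_mul]
    refine Finset.sum_le_card_nsmul _ _ _ fun r _ => ?_
    have := Real.log_le_log (by positivity) (hple a r)
    rw [Real.log_mul (by positivity) (by positivity), Real.log_inv (T : ℝ)] at this
    linarith
  have hrow := fun a => barrierLeader_regret_le (g := fun t => (η * x t a) • u t)
    (m := fun t => P t a) (L := fun t => S t a) (h.S_zero a) (fun t => h.S_succ t a)
    (hppos a) (hp1 a) T
  have hgain : ∀ t, η * ∑ a, x t a * (u t (φ a) - u t a) - 2 * η * (T : ℝ)⁻¹ ≤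
      ∑ a, ∑ r, (p a r - barrierLeader (S t a + P t a) r) * ((η * x t a) • u t) r := by
    intro t
    have hstat : ∑ a, ∑ r, barrierLeader (S t a + P t a) r * ((η * x t a) • u t) r =
        η * ∑ a, x t a * u t a := by
      rw [Finset.sum_comm, Finset.mul_sum]
      refine Finset.sum_congr rfl fun r _ => ?_
      rw [← (h.isStationaryDist t).2 r, Finset.sum_mul, Finset.mul_sum]
      refine Finset.sum_congr rfl fun a _ => ?_
      simp only [Pi.smul_apply, smul_eq_mul]
      ring
    have hmix : ∀ a, η * (x t a * u t (φ a)) - 2 * η * (T : ℝ)⁻¹ * x t a ≤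
        ∑ r, p a r * ((η * x t a) • u t) r := by
      intro a
      have h1 : ∑ r, p a r * ((η * x t a) • u t) r = η * x t a *
          ((1 - (T : ℝ)⁻¹) * u t (φ a) + (T : ℝ)⁻¹ * ((Fintype.card ι : ℝ)⁻¹ * ∑ r, u t r)) := by
        have h2 : ∀ r, p a r * ((η * x t a) • u t) r = η * x t a *
            ((1 - (T : ℝ)⁻¹) * (if r = φ a then u t r else 0)
              + (T : ℝ)⁻¹ * ((Fintype.card ι : ℝ)⁻¹ * u t r)) := by
          intro r
          simp only [hp, Pi.smul_apply, smul_eq_mul]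
          split_ifs <;> ring
        rw [Finset.sum_congr rfl fun r _ => h2 r, ← Finset.mul_sum, Finset.sum_add_distrib,
          ← Finset.mul_sum, ← Finset.mul_sum, ← Finset.mul_sum]
        simp
      have h3 : -1 ≤ (Fintype.card ι : ℝ)⁻¹ * ∑ r, u t r := by
        have : -(Fintype.card ι : ℝ) ≤ ∑ r, u t r := by
          have := Finset.card_nsmul_le_sum Finset.univ (u t) (-1)
            fun r _ => (abs_le.1 (h.abs_le_one t r)).1
          simpa using this
        have h4 := mul_le_mul_of_nonneg_left this (inv_pos.2 hcard).le
        rwa [mul_neg, inv_mul_cancel₀ hcard.ne'] at h4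
      have h5 := (abs_le.1 (h.abs_le_one t (φ a))).2
      have h6 : 0 ≤ η * x t a := mul_nonneg h.rate_nonneg (h.nonneg t a)
      have h7 : (0 : ℝ) ≤ (T : ℝ)⁻¹ := (inv_pos.2 hTpos).le
      rw [h1]
      have h8 : 0 ≤ η * x t a * ((T : ℝ)⁻¹ *
          ((1 - u t (φ a)) + ((Fintype.card ι : ℝ)⁻¹ * ∑ r, u t r + 1))) :=
        mul_nonneg h6 (mul_nonneg h7 (by linarith))
      linarith
    have hs := Finset.sum_le_sum fun a (_ : a ∈ Finset.univ) => hmix a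
    rw [Finset.sum_sub_distrib, ← Finset.mul_sum, ← Finset.mul_sum, h.sum_eq_one] at hs
    simp only [sub_mul, mul_sub, Finset.sum_sub_distrib]
    rw [hstat]
    linarith
  have hsum := Finset.sum_le_sum fun a (_ : a ∈ Finset.univ) => hrow a
  rw [Finset.sum_sub_distrib, Finset.sum_add_distrib, Finset.sum_comm,
    Finset.sum_comm (s := Finset.univ) (t := Finset.range T)
      (f := fun a t => ‖(η * x t a) • u t - P t a‖ ^ 2),
    Finset.sum_comm (s := Finset.univ) (t := Finset.range T)
      (f := fun a t => ∑ r, logGap (barrierLeader (S t a + P t a) r / barrierLeader (S t a) r))]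
    at hsum
  have hg := Finset.sum_le_sum fun t (_ : t ∈ Finset.range T) => hgain t
  rw [Finset.sum_sub_distrib, ← Finset.mul_sum] at hg
  have hc : ∑ _t ∈ Finset.range T, 2 * η * (T : ℝ)⁻¹ = 2 * η := by
    rw [Finset.sum_const, Finset.card_range, nsmul_eq_mul]; field_simp
  have hl : ∑ a, ∑ r, (Real.log (Fintype.card ι : ℝ)⁻¹ - Real.log (p a r)) ≤
      (Fintype.card ι : ℝ) ^ 2 * Real.log T := by
    refine (Finset.sum_le_card_nsmul _ _ _ fun a _ => hlog a).trans (le_of_eq ?_)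
    rw [nsmul_eq_mul, Finset.card_univ]; ring
  linarith

theorem norm_P_succ_le (h : IsSwapPlay η u x S P) (t : ℕ) (a : ι) :
    ‖P (t + 1) a‖ ≤ η * x t a := by
  have h0 : 0 ≤ η * x t a := mul_nonneg h.rate_nonneg (h.nonneg t a)
  rw [h.P_succ, norm_smul, Real.norm_of_nonneg h0]
  exact mul_le_of_le_one_right h0 (h.norm_le_one t)

/-- Row `a` moves from `S t a + P t a` to `S (t + 1) a`, a prediction error, and then to `S (t + 1)
a + P (t + 1) a`, a divergence term of round `t + 1`. The factor 32 is `4 ^ 2` from the stationary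
distributions times 2 from squaring a sum. -/
theorem sq_variation_le (h : IsSwapPlay η u x S P) (hη : η ≤ 1) (t : ℕ) :
    (∑ b, |x (t + 1) b - x t b|) ^ 2 ≤ 32 * Fintype.card ι *
      (∑ a, ‖(η * x t a) • u t - P t a‖ ^ 2
      + 9 * ∑ a, ∑ r, logGap (barrierLeader (S (t + 1) a + P (t + 1) a) r
          / barrierLeader (S (t + 1) a) r)) := by
  set δ : ι → ℝ := fun a => ‖(η * x t a) • u t - P t a‖ with hδ
  set D : ι → ℝ := fun a => ∑ r, logGap (barrierLeader (S (t + 1) a + P (t + 1) a) r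
          / barrierLeader (S (t + 1) a) r) with hD
  have hD0 : ∀ a, 0 ≤ D a := fun a => Finset.sum_nonneg fun r _ =>
    logGap_nonneg (div_pos (barrierLeader_pos _ r) (barrierLeader_pos _ r))
  have hrow : ∀ a b, |Real.log (barrierLeader (S (t + 1) a + P (t + 1) a) b)
      - Real.log (barrierLeader (S t a + P t a) b)| ≤ δ a + √(9 * D a) := by
    intro a b
    have h1 : |Real.log (barrierLeader (S (t + 1) a + P (t + 1) a) b)
        - Real.log (barrierLeader (S (t + 1) a) b)| ≤ √(9 * D a) := by
      refine Real.abs_le_sqrt ((sq_log_barrierLeader_le _ _ b).trans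
        (sum_sq_ratio_le_sum_logGap ?_))
      rw [add_sub_cancel_left]
      refine (h.norm_P_succ_le t a).trans ?_
      exact mul_le_one₀ hη (h.nonneg t a) (h.le_one t a)
    have h2 : |Real.log (barrierLeader (S (t + 1) a) b)
        - Real.log (barrierLeader (S t a + P t a) b)| ≤ δ a := by
      have h3 := (sq_log_barrierLeader_le (S (t + 1) a) (S t a + P t a) b).trans
        (sum_sq_ratio_barrierLeader_le _ _)
      rw [h.S_succ, add_sub_add_left_eq_sub] at h3
      rw [h.S_succ]
      exact abs_le_of_sq_le_sq h3 (norm_nonneg _)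
    have := abs_sub_le (Real.log (barrierLeader (S (t + 1) a + P (t + 1) a) b))
      (Real.log (barrierLeader (S (t + 1) a) b)) (Real.log (barrierLeader (S t a + P t a) b))
    linarith
  have hl1 := (h.isStationaryDist t).sum_abs_sub_le (isPosStochastic_barrierLeader _)
    (isPosStochastic_barrierLeader _) (h.isStationaryDist (t + 1)) hrow
  have hsq := pow_le_pow_left₀ (Finset.sum_nonneg fun b _ => abs_nonneg _) hl1 2
  have hcs : (∑ a, (δ a + √(9 * D a))) ^ 2 ≤
      Fintype.card ι * ∑ a, (δ a + √(9 * D a)) ^ 2 := by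
    simpa using sq_sum_le_card_mul_sum_sq (s := (Finset.univ : Finset ι))
      (f := fun a => δ a + √(9 * D a))
  have hterm : ∑ a, (δ a + √(9 * D a)) ^ 2 ≤ ∑ a, (2 * δ a ^ 2 + 18 * D a) := by
    refine Finset.sum_le_sum fun a _ => ?_
    have := Real.sq_sqrt (show 0 ≤ 9 * D a from mul_nonneg (by norm_num) (hD0 a))
    nlinarith [sq_nonneg (δ a - √(9 * D a))]
  rw [Finset.sum_add_distrib, ← Finset.mul_sum, ← Finset.mul_sum] at hterm
  have hc : (0 : ℝ) ≤ Fintype.card ι := Nat.cast_nonneg _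
  have := mul_le_mul_of_nonneg_left hterm hc
  rw [mul_pow] at hsq
  linarith

theorem sum_sq_prediction_error_zero_le (h : IsSwapPlay η u x S P) :
    ∑ a, ‖(η * x 0 a) • u 0 - P 0 a‖ ^ 2 ≤ η ^ 2 := by
  have hη := h.rate_nonneg
  calc ∑ a, ‖(η * x 0 a) • u 0 - P 0 a‖ ^ 2 ≤ ∑ a, η ^ 2 * x 0 a := by
        refine Finset.sum_le_sum fun a _ => ?_
        have h0 : 0 ≤ η * x 0 a := mul_nonneg hη (h.nonneg 0 a)
        rw [h.P_zero, sub_zero, norm_smul, Real.norm_of_nonneg h0]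
        have h1 : (η * x 0 a * ‖u 0‖) ^ 2 ≤ (η * x 0 a) ^ 2 :=
          pow_le_pow_left₀ (by positivity)
            (mul_le_of_le_one_right h0 (h.norm_le_one 0)) 2
        refine h1.trans ?_
        rw [mul_pow]
        refine mul_le_mul_of_nonneg_left ?_ (sq_nonneg η)
        nlinarith [h.nonneg 0 a, h.le_one 0 a]
    _ = η ^ 2 := by rw [← Finset.mul_sum, h.sum_eq_one, mul_one]

/-- Split the change of `x a • u` by the product rule; `∑ x a ^ 2 ≤ 1` keeps the utility part free
of a factor `card ι`. -/
theorem sum_sq_prediction_error_succ_le (h : IsSwapPlay η u x S P) (t : ℕ) :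
    ∑ a, ‖(η * x (t + 1) a) • u (t + 1) - P (t + 1) a‖ ^ 2 ≤
      2 * η ^ 2 * (‖u (t + 1) - u t‖ ^ 2 + (∑ b, |x (t + 1) b - x t b|) ^ 2) := by
  have hη := h.rate_nonneg
  have hterm : ∀ a, ‖(η * x (t + 1) a) • u (t + 1) - P (t + 1) a‖ ^ 2 ≤
      2 * η ^ 2 * (x (t + 1) a * ‖u (t + 1) - u t‖ ^ 2 + |x (t + 1) a - x t a| ^ 2) := by
    intro a
    have hx := h.nonneg (t + 1) a
    have h1 : (η * x (t + 1) a) • u (t + 1) - P (t + 1) a =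
        η • (x (t + 1) a • (u (t + 1) - u t) + (x (t + 1) a - x t a) • u t) := by
      rw [h.P_succ]
      ext r
      simp only [Pi.sub_apply, Pi.smul_apply, Pi.add_apply, smul_eq_mul]
      ring
    have h2 : ‖x (t + 1) a • (u (t + 1) - u t) + (x (t + 1) a - x t a) • u t‖ ≤
        x (t + 1) a * ‖u (t + 1) - u t‖ + |x (t + 1) a - x t a| := by
      refine (norm_add_le _ _).trans (add_le_add ?_ ?_)
      · rw [norm_smul, Real.norm_of_nonneg hx]
      · rw [norm_smul, Real.norm_eq_abs]
        exact mul_le_of_le_one_right (abs_nonneg _) (h.norm_le_one t)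
    rw [h1, norm_smul, mul_pow, Real.norm_of_nonneg hη]
    have h3 := pow_le_pow_left₀ (norm_nonneg _) h2 2
    have h4 : (x (t + 1) a * ‖u (t + 1) - u t‖) ^ 2 ≤ x (t + 1) a * ‖u (t + 1) - u t‖ ^ 2 := by
      rw [mul_pow]
      refine mul_le_mul_of_nonneg_right ?_ (sq_nonneg _)
      nlinarith [h.le_one (t + 1) a]
    rw [mul_comm 2 (η ^ 2), mul_assoc]
    refine mul_le_mul_of_nonneg_left ?_ (sq_nonneg η)
    nlinarith [sq_nonneg (x (t + 1) a * ‖u (t + 1) - u t‖ - |x (t + 1) a - x t a|)]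
  refine (Finset.sum_le_sum fun a _ => hterm a).trans ?_
  rw [← Finset.mul_sum, Finset.sum_add_distrib, ← Finset.sum_mul, h.sum_eq_one, one_mul]
  refine mul_le_mul_of_nonneg_left ?_ (by positivity)
  exact add_le_add le_rfl (Finset.sum_sq_le_sq_sum_of_nonneg fun b _ => abs_nonneg _)

/-- Regret bounded by variation in utilities, for the swap regret. -/
theorem swapRegret_add_variation_le (h : IsSwapPlay η u x S P) (hη : η ≤ 1)
    (hη2 : η ^ 2 * (1280 * Fintype.card ι) ≤ 1) {K : ℕ} (hK : 1 ≤ K) (φ : ι → ι) :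
    η * ∑ t ∈ Finset.range (K + 1), ∑ a, x t a * (u t (φ a) - u t a)
      + (∑ t ∈ Finset.range K, (∑ b, |x (t + 1) b - x t b|) ^ 2) / (576 * Fintype.card ι) ≤
      (Fintype.card ι : ℝ) ^ 2 * Real.log (K + 1 : ℕ) + 4
      + 20 / 9 * η ^ 2 * ∑ t ∈ Finset.range K, ‖u (t + 1) - u t‖ ^ 2 := by
  have hη0 := h.rate_nonneg
  have hcard : (0 : ℝ) < Fintype.card ι := by exact_mod_cast Fintype.card_pos
  have hreg := h.swapRegret_le (T := K + 1) (by omega) φ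
  set E : ℕ → ℝ := fun t => ∑ a, ‖(η * x t a) • u t - P t a‖ ^ 2 with hE
  set D : ℕ → ℝ := fun t => ∑ a, ∑ r,
    logGap (barrierLeader (S t a + P t a) r / barrierLeader (S t a) r) with hD
  set V : ℕ → ℝ := fun t => (∑ b, |x (t + 1) b - x t b|) ^ 2 with hV
  set U : ℕ → ℝ := fun t => ‖u (t + 1) - u t‖ ^ 2 with hU
  change η * _ + (∑ t ∈ Finset.range K, V t) / _ ≤
    _ + 20 / 9 * η ^ 2 * ∑ t ∈ Finset.range K, U t
  change _ ≤ _ + ∑ t ∈ Finset.range (K + 1), E t - ∑ t ∈ Finset.range (K + 1), D t at hreg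
  have hD0 : ∀ t, 0 ≤ D t := fun t => Finset.sum_nonneg fun a _ => Finset.sum_nonneg fun r _ =>
    logGap_nonneg (div_pos (barrierLeader_pos _ r) (barrierLeader_pos _ r))
  have hE0 : ∀ t, 0 ≤ E t := fun t => Finset.sum_nonneg fun a _ => by positivity
  have hVle : ∀ t, V t / (288 * Fintype.card ι) ≤ E t / 9 + D (t + 1) := by
    intro t
    rw [div_le_iff₀ (by positivity)]
    have : V t ≤ 32 * Fintype.card ι * (E t + 9 * D (t + 1)) := h.sq_variation_le hη t
    linarith
  have hEsucc : ∀ t, E (t + 1) ≤ 2 * η ^ 2 * (U t + V t) := h.sum_sq_prediction_error_succ_le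
  have hEzero : E 0 ≤ η ^ 2 := h.sum_sq_prediction_error_zero_le
  have hs1 := Finset.sum_le_sum fun t (_ : t ∈ Finset.range K) => hVle t
  rw [Finset.sum_add_distrib, ← Finset.sum_div, ← Finset.sum_div] at hs1
  have hs2 := Finset.sum_le_sum fun t (_ : t ∈ Finset.range K) => hEsucc t
  rw [← Finset.mul_sum, Finset.sum_add_distrib] at hs2
  have hDsum := Finset.sum_range_succ' D K
  have hEsum := Finset.sum_range_succ' E K
  have hElast := Finset.sum_range_succ E K
  -- The errors enter with weight `1 + 1 / 9`, the `1 / 9` coming from `hVle`. Their own-variation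
  -- part uses up at most half of the available `1 / (288 * card ι)`, since `1280 = 576 * 20 / 9`.
  have hη3 : 2 * η ^ 2 * (10 / 9) ≤ 1 / (576 * Fintype.card ι) := by
    rw [le_div_iff₀ (by positivity)]
    linarith
  have hV0 : 0 ≤ ∑ t ∈ Finset.range K, V t := Finset.sum_nonneg fun t _ => sq_nonneg _
  have hs3 := mul_le_mul_of_nonneg_right hη3 hV0
  have hhalf : (∑ t ∈ Finset.range K, V t) / (288 * Fintype.card ι) =
      2 * ((∑ t ∈ Finset.range K, V t) / (576 * Fintype.card ι)) := by
    field_simp; ring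
  have h1 : 1 / (576 * (Fintype.card ι : ℝ)) * ∑ t ∈ Finset.range K, V t =
      (∑ t ∈ Finset.range K, V t) / (576 * Fintype.card ι) := by ring
  have hη4 : η ^ 2 ≤ 1 := pow_le_one₀ hη0 hη
  have := hD0 0
  have := hE0 K
  linarith

end IsSwapPlay

end SwapRegret

/-! ### Product distributions: `ℓ¹` distance and swap deviations. -/

section ProductDistribution

variable {n : ℕ} {m : Fin n → ℕ}

theorem sum_productDistribution (x : ∀ j, Fin (m j) → ℝ) :
    ∑ a, productDistribution x a = ∏ j, ∑ b, x j b := by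
  rw [Finset.prod_univ_sum, Fintype.piFinset_univ]
  rfl

theorem productDistribution_mem_stdSimplex {x : ∀ j, Fin (m j) → ℝ}
    (hx : ∀ j, x j ∈ stdSimplex ℝ (Fin (m j))) :
    productDistribution x ∈ stdSimplex ℝ (∀ j, Fin (m j)) := by
  refine ⟨fun a => Finset.prod_nonneg fun j _ => (hx j).1 (a j), ?_⟩
  rw [sum_productDistribution]
  exact Finset.prod_eq_one fun j _ => (hx j).2

/-- The `ℓ¹` distance of product distributions is at most the sum of the marginal distances. -/
theorem sum_abs_productDistribution_sub_le {x y : ∀ j, Fin (m j) → ℝ}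
    (hx : ∀ j, x j ∈ stdSimplex ℝ (Fin (m j))) (hy : ∀ j, y j ∈ stdSimplex ℝ (Fin (m j))) :
    ∑ a, |productDistribution x a - productDistribution y a| ≤ ∑ j, ∑ b, |x j b - y j b| := by
  -- Hybrid argument: exchange one marginal at a time, all other marginals having mass 1.
  have key : ∀ s : Finset (Fin n),
      ∑ a, |productDistribution (fun j => if j ∈ s then x j else y j) a
        - productDistribution y a| ≤ ∑ j ∈ s, ∑ b, |x j b - y j b| := by
    intro s
    induction s using Finset.induction_on with
    | empty => simp
    | insert k s hk ih =>
      set z : ∀ j, Fin (m j) → ℝ := fun j => if j ∈ s then x j else y j with hz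
      set z' : ∀ j, Fin (m j) → ℝ := fun j => if j ∈ insert k s then x j else y j with hz'
      have hzmem : ∀ j, z j ∈ stdSimplex ℝ (Fin (m j)) := by
        intro j
        by_cases hj : j ∈ s
        · simpa only [hz, hj, if_true] using hx j
        · simpa only [hz, hj, if_false] using hy j
      have hzk : z k = y k := by simp only [hz, hk, if_false]
      have hzk' : z' k = x k := by simp only [hz', Finset.mem_insert_self, if_true]
      have hzj : ∀ j, j ≠ k → z' j = z j := by
        intro j hj
        simp only [hz, hz', Finset.mem_insert, hj, false_or]
      have hstep : ∀ a, |productDistribution z' a - productDistribution z a| =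
          productDistribution (Function.update z k fun b => |x k b - y k b|) a := by
        intro a
        simp only [productDistribution]
        rw [← Finset.mul_prod_erase _ _ (Finset.mem_univ k),
          ← Finset.mul_prod_erase _ (fun j => z j (a j)) (Finset.mem_univ k),
          ← Finset.mul_prod_erase _ (fun j => Function.update z k _ j (a j)) (Finset.mem_univ k),
          hzk, hzk', Function.update_self]
        have h1 : ∏ j ∈ Finset.univ.erase k, z' j (a j) =
            ∏ j ∈ Finset.univ.erase k, z j (a j) :=
          Finset.prod_congr rfl fun j hj => by rw [hzj j (Finset.ne_of_mem_erase hj)]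
        have h2 : ∏ j ∈ Finset.univ.erase k,
              Function.update z k (fun b => |x k b - y k b|) j (a j) =
            ∏ j ∈ Finset.univ.erase k, z j (a j) :=
          Finset.prod_congr rfl fun j hj => by
            rw [Function.update_of_ne (Finset.ne_of_mem_erase hj)]
        rw [h1, h2, ← sub_mul, abs_mul,
          abs_of_nonneg (Finset.prod_nonneg fun j _ => (hzmem j).1 (a j))]
      have hl1 : ∑ a, |productDistribution z' a - productDistribution z a| =
          ∑ b, |x k b - y k b| := by
        rw [Finset.sum_congr rfl fun a _ => hstep a, sum_productDistribution,
          ← Finset.mul_prod_erase _ _ (Finset.mem_univ k), Function.update_self,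
          Finset.prod_eq_one, mul_one]
        intro j hj
        rw [Function.update_of_ne (Finset.ne_of_mem_erase hj)]
        exact (hzmem j).2
      rw [Finset.sum_insert hk, ← hl1]
      refine le_trans ?_ (add_le_add le_rfl ih)
      rw [← Finset.sum_add_distrib]
      exact Finset.sum_le_sum fun a _ => abs_sub_le _ _ _
  simpa using key Finset.univ

theorem update_single_mem_stdSimplex {x : ∀ j, Fin (m j) → ℝ}
    (hx : ∀ j, x j ∈ stdSimplex ℝ (Fin (m j))) (i : Fin n) (b : Fin (m i)) (j : Fin n) :
    Function.update x i (Pi.single b 1) j ∈ stdSimplex ℝ (Fin (m j)) := by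
  by_cases hj : j = i
  · subst hj
    rw [Function.update_self]
    exact single_mem_stdSimplex ℝ b
  · rw [Function.update_of_ne hj]
    exact hx j

/-- Splitting a profile into the action of `i` and the actions of the others reduces both sides to
the same double sum. With `F` the utility of `i`, the inner sum on the right is the feedback at `φ
b`. -/
theorem sum_productDistribution_mul_update (x : ∀ j, Fin (m j) → ℝ) (i : Fin n)
    (φ : Fin (m i) → Fin (m i)) (F : (∀ j, Fin (m j)) → ℝ) :
    ∑ a, productDistribution x a * F (Function.update a i (φ (a i))) =
      ∑ b, x i b * ∑ a, F a * productDistribution (Function.update x i (Pi.single (φ b) 1)) a := by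
  set e := (Equiv.piSplitAt i fun j => Fin (m j)).symm with he
  have hei : ∀ p, e p i = p.1 := fun p => by simp [he, Equiv.piSplitAt]
  have hej : ∀ p (j : {j // j ≠ i}), e p j = p.2 j := fun p j => by
    simp [he, Equiv.piSplitAt, j.2]
  have hupd : ∀ p c, Function.update (e p) i c = e (c, p.2) := by
    intro p c
    ext1 j
    by_cases hj : j = i
    · subst hj; rw [Function.update_self, hei]
    · rw [Function.update_of_ne hj, hej p ⟨j, hj⟩, hej (c, p.2) ⟨j, hj⟩]
  have hprod : ∀ (y : ∀ j, Fin (m j) → ℝ) p, productDistribution y (e p) =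
      y i p.1 * ∏ j : {j // j ≠ i}, y j (p.2 j) := by
    intro y p
    rw [productDistribution, ← Finset.mul_prod_erase _ _ (Finset.mem_univ i), hei,
      Finset.prod_subtype (p := fun j => j ≠ i) _ (by simp)]
    exact congrArg _ (Finset.prod_congr rfl fun j _ => by rw [hej])
  have hmarg : ∀ c, ∑ a, F a * productDistribution (Function.update x i (Pi.single c 1)) a =
      ∑ r : (∀ j : {j // j ≠ i}, Fin (m j)), F (e (c, r)) * ∏ j : {j // j ≠ i}, x j (r j) := by
    intro c
    rw [← Equiv.sum_comp e, Fintype.sum_prod_type, Finset.sum_eq_single c]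
    · refine Finset.sum_congr rfl fun r _ => ?_
      rw [hprod, Function.update_self, Pi.single_eq_same, one_mul]
      exact congrArg _ (Finset.prod_congr rfl fun j _ => by rw [Function.update_of_ne j.2])
    · intro b _ hb
      refine Finset.sum_eq_zero fun r _ => ?_
      rw [hprod, Function.update_self, Pi.single_eq_of_ne hb, zero_mul, mul_zero]
    · simp
  rw [← Equiv.sum_comp e, Fintype.sum_prod_type]
  refine Finset.sum_congr rfl fun b _ => ?_
  rw [hmarg, Finset.mul_sum]
  refine Finset.sum_congr rfl fun r _ => ?_
  rw [hprod, hupd, hei]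
  ring

end ProductDistribution

/-! ### From swap regrets to approximate correlated equilibria. -/

namespace FiniteGame

variable {n : ℕ} {m : Fin n → ℕ} (G : FiniteGame n m)

theorem abs_utility_le_one (i : Fin n) (a : ∀ j, Fin (m j)) : |G.utility i a| ≤ 1 :=
  abs_le.2 (G.utility_mem i a)

theorem norm_feedback_le_one {x : ∀ j, Fin (m j) → ℝ}
    (hx : ∀ j, x j ∈ stdSimplex ℝ (Fin (m j))) (i : Fin n) : ‖G.feedback x i‖ ≤ 1 := by
  refine (pi_norm_le_iff_of_nonneg zero_le_one).2 fun b => ?_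
  have hmem := productDistribution_mem_stdSimplex (update_single_mem_stdSimplex hx i b)
  rw [Real.norm_eq_abs, feedback, expectedUtility]
  refine ((Finset.abs_sum_le_sum_abs _ _).trans (Finset.sum_le_sum fun a _ => ?_)).trans_eq hmem.2
  rw [abs_mul, abs_of_nonneg (hmem.1 a)]
  exact mul_le_of_le_one_left (hmem.1 a) (G.abs_utility_le_one i a)

theorem norm_feedback_sub_le {x y : ∀ j, Fin (m j) → ℝ}
    (hx : ∀ j, x j ∈ stdSimplex ℝ (Fin (m j))) (hy : ∀ j, y j ∈ stdSimplex ℝ (Fin (m j)))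
    (i : Fin n) : ‖G.feedback x i - G.feedback y i‖ ≤ ∑ j, ∑ b, |x j b - y j b| := by
  refine (pi_norm_le_iff_of_nonneg (Finset.sum_nonneg fun j _ =>
    Finset.sum_nonneg fun b _ => abs_nonneg _)).2 fun b => ?_
  have hl1 := sum_abs_productDistribution_sub_le (update_single_mem_stdSimplex hx i b)
    (update_single_mem_stdSimplex hy i b)
  have hle : ∑ j, ∑ c, |Function.update x i (Pi.single b 1) j c
      - Function.update y i (Pi.single b 1) j c| ≤ ∑ j, ∑ c, |x j c - y j c| := by
    refine Finset.sum_le_sum fun j _ => ?_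
    by_cases hj : j = i
    · subst hj
      simp only [Function.update_self, sub_self, abs_zero, Finset.sum_const_zero]
      exact Finset.sum_nonneg fun b _ => abs_nonneg _
    · simp only [Function.update_of_ne hj, le_refl]
  refine le_trans ?_ (hl1.trans hle)
  rw [Real.norm_eq_abs, Pi.sub_apply, feedback, feedback, expectedUtility, expectedUtility,
    ← Finset.sum_sub_distrib]
  refine (Finset.abs_sum_le_sum_abs _ _).trans (Finset.sum_le_sum fun a _ => ?_)
  rw [← mul_sub, abs_mul]
  exact mul_le_of_le_one_left (abs_nonneg _) (G.abs_utility_le_one i a)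

variable {k : Fin n → ℕ} (L : ∀ i, UncoupledLearner (m i) (k i))

theorem strategiesAfter_mem (t : ℕ) (i : Fin n) :
    G.strategiesAfter L t i ∈ stdSimplex ℝ (Fin (m i)) :=
  (L i).strategy_mem _

theorem averagePlay_mem_stdSimplex {T : ℕ} (hT : T ≠ 0) :
    G.averagePlay L T ∈ stdSimplex ℝ (∀ j, Fin (m j)) := by
  have hmem := fun t => productDistribution_mem_stdSimplex (G.strategiesAfter_mem L t)
  refine ⟨fun a => mul_nonneg (by positivity) (Finset.sum_nonneg fun t _ => (hmem t).1 a), ?_⟩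
  simp only [averagePlay]
  rw [← Finset.mul_sum, Finset.sum_comm, Finset.sum_congr rfl fun t _ => (hmem t).2]
  simp [hT]

/-- The swap deviations against the average play, in terms of the utility vectors received. -/
theorem sum_averagePlay_mul_update (T : ℕ) (i : Fin n) (φ : Fin (m i) → Fin (m i)) :
    ∑ a, G.averagePlay L T a * G.utility i (Function.update a i (φ (a i))) =
      1 / (T : ℝ) * ∑ t ∈ Finset.range T, ∑ b, G.strategiesAfter L t i b *
        G.feedback (G.strategiesAfter L t) i (φ b) := by
  simp only [averagePlay, mul_assoc, Finset.sum_mul]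
  rw [← Finset.mul_sum, Finset.sum_comm]
  congr 1
  refine Finset.sum_congr rfl fun t _ => ?_
  exact sum_productDistribution_mul_update _ i φ (G.utility i)

theorem isApproxCorrelatedEquilibrium_averagePlay {ε : ℝ} (hε : 0 ≤ ε) {T : ℕ} (hT : T ≠ 0)
    (h : ∀ (i : Fin n) (φ : Fin (m i) → Fin (m i)),
      ∑ t ∈ Finset.range T, ∑ b, G.strategiesAfter L t i b *
        (G.feedback (G.strategiesAfter L t) i (φ b) - G.feedback (G.strategiesAfter L t) i b)
        ≤ T * ε) :
    G.IsApproxCorrelatedEquilibrium ε (G.averagePlay L T) := by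
  refine ⟨hε, G.averagePlay_mem_stdSimplex L hT, fun i φ => ?_⟩
  have hid := G.sum_averagePlay_mul_update L T i id
  simp only [id, Function.update_eq_self] at hid
  have hi := h i φ
  simp only [mul_sub, Finset.sum_sub_distrib] at hi
  rw [hid, G.sum_averagePlay_mul_update L T i φ, ge_iff_le, sub_le_iff_le_add]
  have hTpos : (0 : ℝ) < T := by exact_mod_cast Nat.pos_of_ne_zero hT
  rw [← sub_le_iff_le_add', ← mul_sub, one_div_mul_eq_div, div_le_iff₀ hTpos]
  linarith

end FiniteGame

/-! ### The learner storing `2 * m` vectors, and the regret when all players use it. -/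

/-- The strategy of the swap-regret minimizer as a function of its memory. For each action `a`, the
memory holds the cumulative utility (index `(0, a)`) and the last utility (index `(1, a)`) of the
component external-regret minimizer for `a`. -/
noncomputable def memoryStrategy {m : ℕ} [Nonempty (Fin m)] (s : Fin (2 * m) → Fin m → ℝ) :
    Fin m → ℝ :=
  swapStrategy (fun a => s (finProdFinEquiv (0, a))) (fun a => s (finProdFinEquiv (1, a)))

theorem continuous_memoryStrategy {m : ℕ} [Nonempty (Fin m)] :
    Continuous (memoryStrategy : (Fin (2 * m) → Fin m → ℝ) → Fin m → ℝ) := by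
  unfold memoryStrategy
  exact Continuous.swapStrategy (continuous_pi fun a => continuous_apply (finProdFinEquiv (0, a)))
    (continuous_pi fun a => continuous_apply (finProdFinEquiv (1, a)))

/-- The swap-regret minimizer with learning rate `η` as an uncoupled learner. -/
noncomputable def swapLearner (η : ℝ) (m : ℕ) [Nonempty (Fin m)] : UncoupledLearner m (2 * m) where
  init := 0
  strategy := memoryStrategy
  update s u := fun k =>
    -- Slots `(0, a)` accumulate the scaled utilities; slots `(1, a)` are overwritten by the latest
    -- one, the next prediction.
    (if (finProdFinEquiv.symm k).1 = 0 then s k else 0)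
      + (η * memoryStrategy s (finProdFinEquiv.symm k).2) • u
  strategy_mem s := (isStationaryDist_swapStrategy _ _).1
  continuous_strategy := continuous_memoryStrategy
  continuous_update := by
    refine continuous_pi fun k => Continuous.fun_add ?_ (Continuous.fun_smul ?_ continuous_snd)
    · split_ifs
      · exact (continuous_apply k).comp continuous_fst
      · exact continuous_const
    · exact continuous_const.mul
        ((continuous_apply _).comp (continuous_memoryStrategy.comp continuous_fst))

namespace FiniteGame

variable {n : ℕ} {m : Fin n → ℕ} (G : FiniteGame n m)

theorem isSwapPlay_swapLearner [∀ i, Nonempty (Fin (m i))] {η : ℝ} (hη : 0 ≤ η) (i : Fin n) :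
    IsSwapPlay η
      (fun t => G.feedback (G.strategiesAfter (fun i => swapLearner η (m i)) t) i)
      (fun t => G.strategiesAfter (fun i => swapLearner η (m i)) t i)
      (fun t a => G.memoryAfter (fun i => swapLearner η (m i)) t i (finProdFinEquiv (0, a)))
      (fun t a => G.memoryAfter (fun i => swapLearner η (m i)) t i (finProdFinEquiv (1, a))) where
  S_zero a := rfl
  P_zero a := rfl
  S_succ t a := by
    simp only [memoryAfter, swapLearner, Equiv.symm_apply_apply, if_true]
    rfl
  P_succ t a := by
    simp only [memoryAfter, swapLearner, Equiv.symm_apply_apply, one_ne_zero, if_false, zero_add]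
    rfl
  strategy t := rfl
  rate_nonneg := hη
  norm_le_one t := G.norm_feedback_le_one (G.strategiesAfter_mem _ t) i

/-- Each player's swap regret is logarithmic when all players follow the swap learner. -/
theorem swapRegret_swapLearner_le [∀ i, Nonempty (Fin (m i))] {η N M : ℝ} (hη : 0 ≤ η)
    (hN : (n : ℝ) ≤ N) (hN1 : 1 ≤ N) (hM1 : 1 ≤ M) (hM : ∀ i, (m i : ℝ) ≤ M)
    (hrate : η ^ 2 * (4096 * M * N ^ 2) = 1) {K : ℕ} (hK : 1 ≤ K) (i : Fin n)
    (φ : Fin (m i) → Fin (m i)) :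
    η * ∑ t ∈ Finset.range (K + 1),
        ∑ b, G.strategiesAfter (fun i => swapLearner η (m i)) t i b *
        (G.feedback (G.strategiesAfter (fun i => swapLearner η (m i)) t) i (φ b)
          - G.feedback (G.strategiesAfter (fun i => swapLearner η (m i)) t) i b) ≤
      2 * (M ^ 2 * Real.log (K + 1 : ℕ) + 4) := by
  set x := G.strategiesAfter (fun i => swapLearner η (m i)) with hx
  have hplay := fun i => G.isSwapPlay_swapLearner hη i
  have hN2 : 1 ≤ N ^ 2 := one_le_pow₀ hN1
  have hη1 : η ≤ 1 := by
    have h1 : 1 ≤ 4096 * M * N ^ 2 := by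
      nlinarith [mul_nonneg (sub_nonneg.2 hM1) (sub_nonneg.2 hN2)]
    refine (sq_le_one_iff₀ hη).1 ?_
    nlinarith [mul_nonneg (sq_nonneg η) (sub_nonneg.2 h1)]
  have hlog : 0 ≤ Real.log (K + 1 : ℕ) := Real.log_natCast_nonneg _
  set V : Fin n → ℝ := fun i => ∑ t ∈ Finset.range K, (∑ b, |x (t + 1) i b - x t i b|) ^ 2 with hV
  have hV0 : ∀ i, 0 ≤ V i := fun i => Finset.sum_nonneg fun t _ => sq_nonneg _
  set W : ℝ := ∑ i, V i with hW
  set B : ℝ := M ^ 2 * Real.log (K + 1 : ℕ) + 4 with hB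
  have hB0 : 0 ≤ B := by positivity
  have hW0 : 0 ≤ W := Finset.sum_nonneg fun i _ => hV0 i
  -- Utilities move at most as much as all strategies together; Cauchy–Schwarz over the players
  -- gives the factor `N`.
  have hutil : ∀ i, ∑ t ∈ Finset.range K, ‖G.feedback (x (t + 1)) i - G.feedback (x t) i‖ ^ 2 ≤
      N * W := by
    intro i
    have hswap : W = ∑ t ∈ Finset.range K, ∑ j, (∑ b, |x (t + 1) j b - x t j b|) ^ 2 :=
      Finset.sum_comm
    refine le_trans ?_ (mul_le_mul_of_nonneg_right hN hW0)
    rw [hswap, Finset.mul_sum]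
    refine Finset.sum_le_sum fun t _ => ?_
    refine (pow_le_pow_left₀ (norm_nonneg _) (G.norm_feedback_sub_le
      (G.strategiesAfter_mem _ (t + 1)) (G.strategiesAfter_mem _ t) i) 2).trans ?_
    simpa using sq_sum_le_card_mul_sum_sq (s := (Finset.univ : Finset (Fin n)))
      (f := fun j => ∑ b, |x (t + 1) j b - x t j b|)
  have hplayer : ∀ (i : Fin n) (φ : Fin (m i) → Fin (m i)),
      η * ∑ t ∈ Finset.range (K + 1), ∑ b, x t i b *
        (G.feedback (x t) i (φ b) - G.feedback (x t) i b) + V i / (576 * M) ≤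
      B + 20 / 9 * η ^ 2 * (N * W) := by
    intro i φ
    have hmpos : (0 : ℝ) < m i := by exact_mod_cast Fin.pos_iff_nonempty.2 inferInstance
    have hcond : η ^ 2 * (1280 * Fintype.card (Fin (m i))) ≤ 1 := by
      rw [← hrate, Fintype.card_fin]
      refine mul_le_mul_of_nonneg_left ?_ (sq_nonneg η)
      nlinarith [hM i, mul_nonneg (sub_nonneg.2 hM1) (sub_nonneg.2 hN2)]
    have h1 := (hplay i).swapRegret_add_variation_le hη1 hcond hK φ
    rw [Fintype.card_fin] at h1
    have h2 : V i / (576 * M) ≤ V i / (576 * m i) :=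
      div_le_div_of_nonneg_left (hV0 i) (by positivity) (by linarith [hM i])
    have h3 : (m i : ℝ) ^ 2 * Real.log (K + 1 : ℕ) ≤ M ^ 2 * Real.log (K + 1 : ℕ) :=
      mul_le_mul_of_nonneg_right (pow_le_pow_left₀ hmpos.le (hM i) 2) hlog
    have h4 := mul_le_mul_of_nonneg_left (hutil i) (by positivity : 0 ≤ 20 / 9 * η ^ 2)
    simp only [hV, hB] at *
    linarith
  -- The identity swap has regret exactly zero, which leaves a bound on the variation alone.
  have hself : ∀ i, V i / (576 * M) ≤ B + 20 / 9 * η ^ 2 * (N * W) := by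
    intro i
    simpa using hplayer i id
  have hsum := Finset.sum_le_sum fun i (_ : i ∈ Finset.univ) => hself i
  rw [← Finset.sum_div, Finset.sum_const, Finset.card_univ, Fintype.card_fin, nsmul_eq_mul] at hsum
  have hη2 : η ^ 2 = 1 / (4096 * M * N ^ 2) := eq_one_div_of_mul_eq_one_left hrate
  have hR0 : 0 ≤ B + 20 / 9 * η ^ 2 * (N * W) := by positivity
  -- After summing over the players `W` is on both sides, with coefficients `1 / 576` and `5 / 9216`
  -- of `W / M`. The difference exceeds `1 / 1152`, so the right-hand occurrence is absorbed.
  have hWle : W ≤ 1152 * M * N * B := by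
    have h1 := hsum.trans (mul_le_mul_of_nonneg_right hN hR0)
    have h2 : N * (B + 20 / 9 * η ^ 2 * (N * W)) = N * B + 5 / 9216 * (W / M) := by
      rw [hη2]; field_simp; ring
    have h3 : W / (576 * M) = 1 / 576 * (W / M) := by field_simp
    have h4 : 0 ≤ W / M := by positivity
    have h5 : W / M ≤ 1152 * (N * B) := by
      change W / (576 * M) ≤ _ at h1
      linarith
    rw [div_le_iff₀ (by linarith)] at h5
    linarith
  have hfinal := hplayer i φ
  have h1 : 20 / 9 * η ^ 2 * (N * W) ≤ 20 / 9 * η ^ 2 * (N * (1152 * M * N * B)) := by gcongr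
  have h2 : 20 / 9 * η ^ 2 * (N * (1152 * M * N * B)) = 5 / 8 * B := by
    rw [hη2]; field_simp; ring
  have h3 : 0 ≤ V i / (576 * M) := div_nonneg (hV0 i) (by linarith)
  linarith

end FiniteGame

theorem corollary2 :
    ∃ (C : ℝ) (c : ℕ) (A : ∀ (_N _M m : ℕ), 2 ≤ m → UncoupledLearner m (c * m)),
      ∀ (N M n : ℕ) (m : Fin n → ℕ) (hm : ∀ i, 2 ≤ m i),
        2 ≤ n → n ≤ N → (∀ i, m i ≤ M) →
        ∀ (G : FiniteGame n m) (T : ℕ), 2 ≤ T →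
          G.IsApproxCorrelatedEquilibrium
            (C * (N : ℝ) * (M : ℝ) ^ (5 / 2 : ℝ) * (Real.log T / T))
            (G.averagePlay (fun i => A N M (m i) (hm i)) T) := by
  -- The constant is `384 = 2 * 3 * 64`: 2 from the joint regret bound, 3 from absorbing the
  -- additive 4 into the logarithm, 64 from the learning rate. The rate makes `η ^ 2 * (4096 * M * N
  -- ^ 2) = 1`.
  refine ⟨384, 2, fun N M m hm =>
    haveI : Nonempty (Fin m) := ⟨⟨0, by omega⟩⟩
    swapLearner (1 / (64 * N * √M)) m, ?_⟩
  intro N M n m hm hn hN hM G T hT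
  have : ∀ i, Nonempty (Fin (m i)) := fun i => ⟨⟨0, by have := hm i; omega⟩⟩
  have hM2 : (2 : ℝ) ≤ M := by exact_mod_cast (hm ⟨0, by omega⟩).trans (hM ⟨0, by omega⟩)
  have hN2 : (2 : ℝ) ≤ N := by exact_mod_cast hn.trans hN
  have hT2 : (2 : ℝ) ≤ T := by exact_mod_cast hT
  have hlogT : Real.log 2 ≤ Real.log T := Real.log_le_log (by norm_num) hT2
  have hlog2 := Real.log_two_gt_d9
  have hsqrt : 0 < √(M : ℝ) := Real.sqrt_pos.2 (by linarith)
  have hsq : √(M : ℝ) ^ 2 = M := Real.sq_sqrt (by linarith)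
  have hpow : (M : ℝ) ^ (5 / 2 : ℝ) = M ^ 2 * √M := by
    rw [show (5 / 2 : ℝ) = (2 : ℕ) + 1 / 2 by norm_num, Real.rpow_add (by linarith),
      Real.rpow_natCast, Real.sqrt_eq_rpow]
  refine G.isApproxCorrelatedEquilibrium_averagePlay _ ?_ (by omega) fun i φ => ?_
  · have : 0 ≤ Real.log T := by linarith
    positivity
  obtain ⟨K, rfl⟩ : ∃ K, T = K + 1 := ⟨T - 1, by omega⟩
  have hreg := G.swapRegret_swapLearner_le (η := 1 / (64 * N * √M)) (N := N) (M := M)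
    (by positivity) (by exact_mod_cast hN) (by linarith) (by linarith)
    (fun i => by exact_mod_cast hM i)
    (by rw [div_pow, mul_pow, hsq]; field_simp; norm_num) (K := K) (by omega) i φ
  rw [one_div_mul_eq_div, div_le_iff₀ (by positivity)] at hreg
  refine hreg.trans ?_
  have hM4 : (4 : ℝ) ≤ M ^ 2 := by nlinarith
  -- Here `M ^ 2 ≥ 4` and `log T ≥ log 2 > 1 / 2`, so `4 ≤ 2 * M ^ 2 * log T`.
  have hB : (M : ℝ) ^ 2 * Real.log (K + 1 : ℕ) + 4 ≤ 3 * (M ^ 2 * Real.log (K + 1 : ℕ)) := by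
    nlinarith
  have hT0 : ((K + 1 : ℕ) : ℝ) ≠ 0 := by positivity
  calc 2 * ((M : ℝ) ^ 2 * Real.log (K + 1 : ℕ) + 4) * (64 * N * √M)
      ≤ 2 * (3 * (M ^ 2 * Real.log (K + 1 : ℕ))) * (64 * N * √M) := by gcongr
    _ = (K + 1 : ℕ) * (384 * N * (M : ℝ) ^ (5 / 2 : ℝ) *
          (Real.log (K + 1 : ℕ) / (K + 1 : ℕ))) := by
        rw [hpow, mul_div_assoc', mul_div_cancel₀ _ hT0]
        ring
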